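/- We work with pointed topological spaces, pointed continuous maps and pointed homotopies ($\simeq$); a homotopy commutative diagram comes with homotopies for its faces, and in a cube the homotopies of the six faces are required to fit together up to homotopy. Homotopy pullbacks and homotopy pushouts are taken in this setting. Let $\eta,\beta\colon W\to A$ be maps with a homotopy pushout whose two legs are the same map $\theta\colon A\to \Sigma_A W$, with given homotopy $\theta\circ\eta\simeq\theta\circ\beta$ (a relative suspension). Let $f\colon \Sigma_A W\to X$ be any map and put $\iota_X=f\circ\theta$. *Ganea construction.* For a map $\iota\colon B\to Y$ put $G_0=B$, $g_0=\iota$, $\alpha_0=\mathrm{id}_B$. Given $g_i\colon G_i\to Y$, let $B\xleftarrow{\eta_i}F_i\xrightarrow{\beta_i}G_i$ be the homotopy pullback of $\iota$ and $g_i$, let $B\xrightarrow{\alpha_{i+1}}G_{i+1}\xleftarrow{\gamma_i}G_i$ be the homotopy pushout of $\eta_i$ and $\beta_i$, and let $g_{i+1}=(g_i,\iota)\colon G_{i+1}\to Y$ be the induced map. Write $G_i=G_i(\iota)$. *Relative category.* $\mathrm{relcat}(\iota)$ is the least $n\ge 0$ such that there is $\sigma\colon Y\to G_n(\iota)$ with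 $g_n\circ\sigma\simeq \mathrm{id}_Y$ and $\sigma\circ\iota\simeq\alpha_n$. *Strong relative category.* $\mathrm{Relcat}(\iota)$ is the least $n\ge0$ such that there are maps $\iota_i\colon B\to Y_i$ ($0\le i\le n$) with $\iota_0$ a homotopy equivalence, $Y_n=Y$, $\iota_n\simeq\iota$, and, for each $0\le i<n$, a homotopy pushout of some maps $B\leftarrow Z_i\to Y_i$ with vertex $Y_{i+1}$ and leg $\iota_{i+1}\colon B\to Y_{i+1}$, together with a map $B\to Z_i$ whose composites with $Z_i\to B$ and $Z_i\to Y_i$ are homotopic to $\mathrm{id}_B$ and $\iota_i$, respectively. *Hopf category.* For $n\ge1$, the maps $\eta\colon W\to A$ and $\alpha_{n-1}\circ\beta\colon W\to G_{n-1}(\iota_X)$ and the homotopy $\iota_X\circ\eta=f\circ\theta\circ\eta\simeq f\circ\theta\circ\beta\simeq g_{n-1}\circ\alpha_{n-1}\circ\beta$ induce a map $W\to F_{n-1}(\iota_X)$. Together with $\mathrm{id}_A$ and $\alpha_{n-1}$ it induces a map of homotopy pushouts $\omega_n\colon\Sigma_A W\to G_n(\iota_X)$. Then $\mathrm{hcat}(f)$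 is the least $n\ge1$ such that there is $\sigma\colon X\to G_n(\iota_X)$ with $g_n\circ\sigma\simeq\mathrm{id}_X$ and $\sigma\circ f\simeq\omega_n$. *Strong Hopf category.* $\mathrm{Hcat}(f)$ is the least $n\ge1$ such that there are maps $\iota_i\colon A\to X_i$ ($0\le i\le n$) and $\zeta_i\colon\Sigma_A W\to X_i$ ($1\le i\le n$) with $\iota_0$ a homotopy equivalence, $X_n=X$, $\zeta_n\simeq f$, and, for each $0\le i<n$, a homotopy commutative cube whose top face is the relative suspension square, whose bottom face is a homotopy pushout of some maps $A\leftarrow Z_i\to X_i$ with legs $\iota_{i+1}\colon A\to X_{i+1}$ and $\chi_i\colon X_i\to X_{i+1}$, and whose vertical edges are a map $W\to Z_i$, the identity of $A$ (on the corner reached by $\eta$), $\iota_i\colon A\to X_i$ (on the corner reached by $\beta$) and $\zeta_{i+1}\colon \Sigma_A W\to X_{i+1}$. Each of these invariants is $\infty$ if there is no such $n$. **Theorem.** For any $f\colon \Sigma_A W\to X$, $$\mathrm{Relcat}(f)\le\mathrm{Hcat}(f)\quad\text{and}\quad \mathrm{relcat}(f)\le\mathrm{hcat}(f).$$ -/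

import Mathlib

open unitInterval

universe u

/-! ### Pointed spaces, pointed maps, pointed homotopies -/

/-- A pointed topological space. -/
structure PtTop : Type (u + 1) where
  carrier : Type u
  [top : TopologicalSpace carrier]
  pt : carrier

namespace PtTop

instance : CoeSort PtTop.{u} (Type u) := ⟨PtTop.carrier⟩

instance (X : PtTop.{u}) : TopologicalSpace X := X.top

end PtTop

/-- A pointed map: a continuous map that preserves the base point. -/
@[ext]
structure PtMap (X Y : PtTop.{u}) where
  toMap : C(X, Y)
  map_pt : toMap X.pt = Y.pt

/-- A pointed homotopy from `f` to `g`: a homotopy that is stationary at the base point. -/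
abbrev PtHomotopy {X Y : PtTop.{u}} (f g : PtMap X Y) : Type u :=
  f.toMap.HomotopyRel g.toMap {X.pt}

/-- `f ≃ g`: the pointed maps `f` and `g` are homotopic through pointed maps. -/
def PtHomotopic {X Y : PtTop.{u}} (f g : PtMap X Y) : Prop :=
  Nonempty (PtHomotopy f g)

namespace PtMap

variable {X Y Z T : PtTop.{u}}

instance : CoeFun (PtMap X Y) (fun _ => X → Y) := ⟨fun f => f.toMap⟩

/-- The identity map. -/
protected def id (X : PtTop.{u}) : PtMap X X := ⟨ContinuousMap.id X, rfl⟩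

/-- The composite `g ∘ f`. -/
def comp (g : PtMap Y Z) (f : PtMap X Y) : PtMap X Z :=
  ⟨g.toMap.comp f.toMap, by simp [f.map_pt, g.map_pt]⟩

/-- `f` is a (pointed) homotopy equivalence. -/
def IsHomotopyEquiv (f : PtMap X Y) : Prop :=
  ∃ g : PtMap Y X, PtHomotopic (g.comp f) (PtMap.id X) ∧ PtHomotopic (f.comp g) (PtMap.id Y)

/-- `s` is a homotopy section of `g`. -/
def IsHomotopySection (s : PtMap Y X) (g : PtMap X Y) : Prop :=
  PtHomotopic (g.comp s) (PtMap.id Y)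

end PtMap

namespace PtHomotopy

variable {X Y Z : PtTop.{u}}

/-- The homotopy `k ∘ H`. -/
def post {f g : PtMap X Y} (H : PtHomotopy f g) (k : PtMap Y Z) :
    PtHomotopy (k.comp f) (k.comp g) :=
  H.compContinuousMap k.toMap

/-- The homotopy `H ∘ k`. -/
def pre {f g : PtMap Y Z} (H : PtHomotopy f g) (k : PtMap X Y) :
    PtHomotopy (f.comp k) (g.comp k) where
  toHomotopy := H.toHomotopy.compContinuousMap k.toMap
  prop' := by
    rintro t x rfl
    exact H.prop t _ k.map_pt

/-- Two pointed homotopies from `f` to `g` are homotopic relative to their end points `f`, `g`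
and to the base point. -/
def Equivalent {f g : PtMap X Y} (H K : PtHomotopy f g) : Prop :=
  H.toContinuousMap.HomotopicRel K.toContinuousMap
    {q : I × X | q.1 = 0 ∨ q.1 = 1 ∨ q.2 = X.pt}

end PtHomotopy

/-! ### Homotopy pullbacks -/

section Pullback

variable {X Y B : PtTop.{u}}

/-- The standard homotopy pullback of `f : X → B ← Y : g`: triples `(x, c, y)` with `c` a path
in `B` from `f x` to `g y`. -/
def hPullback (f : PtMap X B) (g : PtMap Y B) : PtTop.{u} where
  carrier := {p : X × C(I, B) × Y // p.2.1 0 = f p.1 ∧ p.2.1 1 = g p.2.2}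
  pt := ⟨(X.pt, ContinuousMap.const I B.pt, Y.pt), by simp [f.map_pt, g.map_pt]⟩

/-- The projection of the homotopy pullback to the first space. -/
def hPullback.fst (f : PtMap X B) (g : PtMap Y B) : PtMap (hPullback f g) X where
  toMap := ⟨fun p => p.1.1, continuous_fst.comp continuous_subtype_val⟩
  map_pt := rfl

/-- The projection of the homotopy pullback to the second space. -/
def hPullback.snd (f : PtMap X B) (g : PtMap Y B) : PtMap (hPullback f g) Y where
  toMap := ⟨fun p => p.1.2.2, (continuous_snd.comp continuous_snd).comp continuous_subtype_val⟩
  map_pt := rfl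

/-- The tautological homotopy from `f ∘ fst` to `g ∘ snd`. -/
def hPullback.homotopy (f : PtMap X B) (g : PtMap Y B) :
    PtHomotopy (f.comp (hPullback.fst f g)) (g.comp (hPullback.snd f g)) where
  toFun q := q.2.1.2.1 q.1
  continuous_toFun := by
    have h : Continuous (fun q : I × hPullback f g => (q.2.1.2.1, q.1)) :=
      ((continuous_fst.comp (continuous_snd.comp
        (continuous_subtype_val.comp continuous_snd))).prodMk continuous_fst)
    exact ContinuousEval.continuous_eval.comp h
  map_zero_left p := p.2.1
  map_one_left p := p.2.2
  prop' := by
    rintro t x rfl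
    exact f.map_pt.symm

/-- The whisker map `T → X ×ʰ Y` given by `a : T → X`, `b : T → Y` and a homotopy
`f ∘ a ≃ g ∘ b`. -/
def hPullback.lift {T : PtTop.{u}} (f : PtMap X B) (g : PtMap Y B) (a : PtMap T X)
    (b : PtMap T Y) (H : PtHomotopy (f.comp a) (g.comp b)) : PtMap T (hPullback f g) where
  toMap :=
    { toFun := fun t =>
        ⟨(a t, (H.toContinuousMap.comp ContinuousMap.prodSwap).curry t, b t),
          H.map_zero_left t, H.map_one_left t⟩
      continuous_toFun := by
        apply Continuous.subtype_mk
        exact a.toMap.continuous.prodMk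
          ((ContinuousMap.continuous _).prodMk b.toMap.continuous) }
  map_pt := by
    apply Subtype.ext
    refine Prod.ext a.map_pt (Prod.ext ?_ b.map_pt)
    ext s
    exact (H.prop s _ rfl).trans ((f.comp a).map_pt)

end Pullback

/-! ### Homotopy pushouts -/

section Pushout

variable {W X Y T : PtTop.{u}}

/-- The identifications of the reduced double mapping cylinder of `X ← W → Y`: the cylinder
`I × W` is glued to `X` at time `0` and to `Y` at time `1`, and the segment over the base
point is collapsed. -/
inductive DMCRel (f : PtMap W X) (g : PtMap W Y) : X ⊕ (I × W) ⊕ Y → X ⊕ (I × W) ⊕ Y → Prop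
  | left (w : W) : DMCRel f g (.inr (.inl (0, w))) (.inl (f w))
  | right (w : W) : DMCRel f g (.inr (.inl (1, w))) (.inr (.inr (g w)))
  | base (t : I) : DMCRel f g (.inr (.inl (t, W.pt))) (.inl X.pt)

/-- The reduced double mapping cylinder of `f : W → X` and `g : W → Y`, that is, the standard
(pointed) homotopy pushout of `f` and `g`. -/
def DMC (f : PtMap W X) (g : PtMap W Y) : PtTop.{u} where
  carrier := Quot (DMCRel f g)
  pt := Quot.mk _ (.inl X.pt)

/-- The inclusion of `X`. -/
def DMC.inl (f : PtMap W X) (g : PtMap W Y) : PtMap X (DMC f g) where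
  toMap := ⟨fun x => Quot.mk _ (.inl x), continuous_quot_mk.comp continuous_inl⟩
  map_pt := rfl

/-- The inclusion of `Y`. -/
def DMC.inr (f : PtMap W X) (g : PtMap W Y) : PtMap Y (DMC f g) where
  toMap := ⟨fun y => Quot.mk _ (.inr (.inr y)),
    continuous_quot_mk.comp (continuous_inr.comp continuous_inr)⟩
  map_pt := by
    have h1 := Quot.sound (DMCRel.right (f := f) (g := g) W.pt)
    have h2 := Quot.sound (DMCRel.base (f := f) (g := g) 1)
    rw [g.map_pt] at h1
    exact h1.symm.trans h2

/-- The homotopy from `inl ∘ f` to `inr ∘ g` given by the cylinder. -/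
def DMC.glue (f : PtMap W X) (g : PtMap W Y) :
    PtHomotopy ((DMC.inl f g).comp f) ((DMC.inr f g).comp g) where
  toFun q := Quot.mk _ (.inr (.inl q))
  continuous_toFun := continuous_quot_mk.comp (continuous_inr.comp continuous_inl)
  map_zero_left w := Quot.sound (DMCRel.left w)
  map_one_left w := Quot.sound (DMCRel.right w)
  prop' := by
    rintro t x rfl
    exact (Quot.sound (DMCRel.base t)).trans ((DMC.inl f g).comp f).map_pt.symm

/-- The whisker map from the double mapping cylinder given by `a : X → T`, `b : Y → T` and a
homotopy `a ∘ f ≃ b ∘ g`. -/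
def DMC.desc {f : PtMap W X} {g : PtMap W Y} (a : PtMap X T) (b : PtMap Y T)
    (H : PtHomotopy (a.comp f) (b.comp g)) : PtMap (DMC f g) T where
  toMap :=
    { toFun := Quot.lift (Sum.elim a (Sum.elim H b)) (by
        rintro _ _ (w | w | t)
        · exact H.map_zero_left w
        · exact H.map_one_left w
        · exact (H.prop t _ rfl).trans (((a.comp f).map_pt).trans a.map_pt.symm))
      continuous_toFun := continuous_quot_lift _
        (a.toMap.continuous.sumElim ((map_continuous H).sumElim b.toMap.continuous)) }
  map_pt := a.map_pt

/-- The square with edges `f : W → X`, `g : W → Y`, `a : X → T`, `b : Y → T`, commutative up to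
the homotopy `H : a ∘ f ≃ b ∘ g`, is a homotopy pushout: the induced map from the double mapping
cylinder is a pointed homotopy equivalence. -/
def IsHomotopyPushout (f : PtMap W X) (g : PtMap W Y) (a : PtMap X T) (b : PtMap Y T)
    (H : PtHomotopy (a.comp f) (b.comp g)) : Prop :=
  (DMC.desc a b H).IsHomotopyEquiv

end Pushout

/-! ### The Ganea construction and the relative category -/

/-- A space `G` with maps `α : A → G` and `g : G → X` such that `g ∘ α = ι`. -/
structure MapFactor {A X : PtTop.{u}} (ι : PtMap A X) where
  G : PtTop.{u}
  α : PtMap A G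
  g : PtMap G X
  fac : g.comp α = ι

namespace MapFactor

variable {A X : PtTop.{u}} {ι : PtMap A X} (D : MapFactor ι)

/-- The homotopy pullback `F` of `ι : A → X` and `g : G → X`. -/
def F : PtTop.{u} := hPullback ι D.g

/-- The projection `η : F → A`. -/
def η : PtMap D.F A := hPullback.fst ι D.g

/-- The projection `β : F → G`. -/
def β : PtMap D.F D.G := hPullback.snd ι D.g

/-- One step of the Ganea construction: the homotopy pushout of `A ← F → G`, with the inclusion
of `A` and the whisker map to `X`. -/
def next : MapFactor ι where
  G := DMC D.η D.β
  α := DMC.inl D.η D.β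
  g := DMC.desc ι D.g (hPullback.homotopy ι D.g)
  fac := rfl

/-- The map `γ : G → G'` to the next space of the Ganea construction. -/
def γ : PtMap D.G D.next.G := DMC.inr D.η D.β

end MapFactor

section Ganea

variable {A X : PtTop.{u}}

/-- The Ganea construction of `ι : A → X`: the `n`-th term consists of `G_n`, `α_n : A → G_n` and
`g_n : G_n → X`; it starts with `G_0 = A`, `α_0 = id`, `g_0 = ι`. -/
def ganea (ι : PtMap A X) : ℕ → MapFactor ι
  | 0 => ⟨A, PtMap.id A, ι, rfl⟩
  | n + 1 => (ganea ι n).next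

/-- The relative category `relcat ι`: the least `n` such that `g_n : G_n(ι) → X` has a homotopy
section `s` with `s ∘ ι ≃ α_n` (and `⊤` if there is no such `n`). -/
noncomputable def relcat (ι : PtMap A X) : ℕ∞ :=
  sInf {N : ℕ∞ | ∃ n : ℕ, N = n ∧ ∃ s : PtMap X (ganea ι n).G,
    s.IsHomotopySection (ganea ι n).g ∧ PtHomotopic (s.comp ι) (ganea ι n).α}

/-! ### The strong relative category -/

/-- One step `ι_i : A → X_i`, `ι_{i+1} : A → X_{i+1}` in the definition of the strong relative
category: there is a homotopy pushout of `A ← Z → X_i` with vertex `X_{i+1}`, in which `A → X_{i+1}`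
is `ι_{i+1}`, and a map `s : A → Z` such that `A → Z → A` is homotopic to the identity and
`A → Z → X_i` is homotopic to `ι_i`. -/
def IsRelcatStep {Xi Xj : PtTop.{u}} (ιi : PtMap A Xi) (ιj : PtMap A Xj) : Prop :=
  ∃ (Z : PtTop.{u}) (p : PtMap Z A) (z : PtMap Z Xi) (χ : PtMap Xi Xj)
    (K : PtHomotopy (ιj.comp p) (χ.comp z)) (s : PtMap A Z),
    IsHomotopyPushout p z ιj χ K ∧
    PtHomotopic (p.comp s) (PtMap.id A) ∧ PtHomotopic (z.comp s) ιi

/-- `IsRelcatChain n ι`, for `ι : A → X`: there are `ι_0 : A → X_0`, ..., `ι_n = ι : A → X_n = X`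
such that `ι_0` is a homotopy equivalence and consecutive maps are related by a step. -/
def IsRelcatChain : (n : ℕ) → {X : PtTop.{u}} → PtMap A X → Prop
  | 0, _, ι => ι.IsHomotopyEquiv
  | n + 1, _, ι => ∃ (Xn : PtTop.{u}) (ιn : PtMap A Xn), IsRelcatChain n ιn ∧ IsRelcatStep ιn ι

/-- The strong relative category `Relcat ι` (and `⊤` if there is no such `n`). -/
noncomputable def strongRelcat (ι : PtMap A X) : ℕ∞ :=
  sInf {N : ℕ∞ | ∃ n : ℕ, N = n ∧ ∃ ι' : PtMap A X, IsRelcatChain n ι' ∧ PtHomotopic ι' ι}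

end Ganea

/-! ### Relative suspensions and the Hopf category -/

/-- A relative suspension `S = Σ_A W`: a homotopy pushout of `η : W → A` and `β : W → A` with
vertex `S`, both of whose legs are the same map `θ : A → S`. -/
structure RelSuspension (W A S : PtTop.{u}) where
  η : PtMap W A
  β : PtMap W A
  θ : PtMap A S
  H : PtHomotopy (θ.comp η) (θ.comp β)
  isPushout : IsHomotopyPushout η β θ θ H

namespace RelSuspension

variable {W A S X : PtTop.{u}} (R : RelSuspension W A S) (f : PtMap S X)

/-- The homotopy equivalence from the double mapping cylinder of `η` and `β` to `S`. -/
def fromDMC : PtMap (DMC R.η R.β) S := DMC.desc R.θ R.θ R.H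

/-- A homotopy inverse of `fromDMC`. -/
noncomputable def toDMC : PtMap S (DMC R.η R.β) := R.isPushout.choose

/-- The map `ι_X = f ∘ θ`. -/
def ι : PtMap A X := f.comp R.θ

/-- The homotopy `ι_X ∘ η = f ∘ θ ∘ η ≃ f ∘ θ ∘ β = g_m ∘ α_m ∘ β` given by `f ∘ H`. -/
def baseHomotopy (m : ℕ) : PtHomotopy ((R.ι f).comp R.η)
    ((ganea (R.ι f) m).g.comp ((ganea (R.ι f) m).α.comp R.β)) :=
  (PtHomotopy.post R.H f).cast rfl
    (congrArg (fun k : PtMap A X => (k.comp R.β).toMap) (ganea (R.ι f) m).fac.symm)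

/-- The whisker map `W → F_m(ι_X)` given by `η : W → A`, `α_m ∘ β : W → G_m` and the homotopy
`baseHomotopy`. -/
def toFibre (m : ℕ) : PtMap W (ganea (R.ι f) m).F :=
  hPullback.lift (R.ι f) (ganea (R.ι f) m).g R.η ((ganea (R.ι f) m).α.comp R.β)
    (R.baseHomotopy f m)

/-- The map from the double mapping cylinder of `A ← W → A` to the double mapping cylinder
`G_{m+1}(ι_X)` of `A ← F_m → G_m` that is induced by `id : A → A`, `toFibre : W → F_m` and
`α_m : A → G_m`. -/
def omegaDMC (m : ℕ) : PtMap (DMC R.η R.β) (ganea (R.ι f) (m + 1)).G :=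
  DMC.desc (ganea (R.ι f) (m + 1)).α ((ganea (R.ι f) m).γ.comp (ganea (R.ι f) m).α)
    (PtHomotopy.pre (DMC.glue (ganea (R.ι f) m).η (ganea (R.ι f) m).β) (R.toFibre f m))

/-- The map `ω_{m+1} : Σ_A W → G_{m+1}(ι_X)`. -/
noncomputable def omega (m : ℕ) : PtMap S (ganea (R.ι f) (m + 1)).G :=
  (R.omegaDMC f m).comp R.toDMC

/-- The Hopf category `hcat f`: the least `n = m + 1 ≥ 1` such that `g_n : G_n(ι_X) → X` has a
homotopy section `s` with `s ∘ f ≃ ω_n` (and `⊤` if there is no such `n`). -/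
noncomputable def hcat : ℕ∞ :=
  sInf {N : ℕ∞ | ∃ m : ℕ, N = m + 1 ∧ ∃ s : PtMap X (ganea (R.ι f) (m + 1)).G,
    s.IsHomotopySection (ganea (R.ι f) (m + 1)).g ∧ PtHomotopic (s.comp f) (R.omega f m)}

/-! ### The strong Hopf category -/

/-- One step in the definition of the strong Hopf category: the maps `ι_i : A → X_i`,
`ι_{i+1} : A → X_{i+1}` and `ζ_{i+1} : Σ_A W → X_{i+1}` are edges of a homotopy commutative cube
whose top face is the relative suspension square, whose bottom face is a homotopy pushout
of `A ← Z → X_i`, and whose vertical edges are `w : W → Z`, `id : A → A`, `ι_i` and `ζ_{i+1}`.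
The homotopies `K`, `L`, `B`, `P`, `Q` belong to the bottom, left, back, front and right faces. The
last clause says that the six faces fit together: the two homotopies from `ζ_{i+1} ∘ θ ∘ η` to
`ζ_{i+1} ∘ θ ∘ β`, through the top face and through the other five faces, are equivalent. -/
def IsHcatStep {Xi Xj : PtTop.{u}} (ιi : PtMap A Xi) (ιj : PtMap A Xj) (ζ : PtMap S Xj) : Prop :=
  ∃ (Z : PtTop.{u}) (p : PtMap Z A) (z : PtMap Z Xi) (χ : PtMap Xi Xj) (w : PtMap W Z)
    (K : PtHomotopy (ιj.comp p) (χ.comp z))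
    (L : PtHomotopy (p.comp w) R.η)
    (B : PtHomotopy (z.comp w) (ιi.comp R.β))
    (P : PtHomotopy (ζ.comp R.θ) ιj)
    (Q : PtHomotopy (ζ.comp R.θ) (χ.comp ιi)),
    IsHomotopyPushout p z ιj χ K ∧
    PtHomotopy.Equivalent (f := ζ.comp (R.θ.comp R.η)) (g := ζ.comp (R.θ.comp R.β))
      (PtHomotopy.post R.H ζ)
      ((PtHomotopy.pre P R.η).trans <| (PtHomotopy.post L ιj).symm.trans <|
        (PtHomotopy.pre K w).trans <| (PtHomotopy.post B χ).trans (PtHomotopy.pre Q R.β).symm)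

/-- `R.IsHcatChain n ι`, for `ι : A → X`: there are `ι_0 : A → X_0`, ..., `ι_n = ι : A → X_n = X`
such that `ι_0` is a homotopy equivalence and consecutive maps are related by a step. -/
def IsHcatChain : (n : ℕ) → {X : PtTop.{u}} → PtMap A X → Prop
  | 0, _, ι => ι.IsHomotopyEquiv
  | n + 1, _, ι => ∃ (Xn : PtTop.{u}) (ιn : PtMap A Xn), IsHcatChain n ιn ∧
      ∃ ζ, R.IsHcatStep ιn ι ζ

/-- The strong Hopf category `Hcat f`: the least `n = m + 1 ≥ 1` such that there is a chain of
`n` steps, starting with a homotopy equivalence `A → X_0` and ending with `X_n = X` and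
`ζ_n ≃ f` (and `⊤` if there is no such `n`). -/
noncomputable def strongHcat : ℕ∞ :=
  sInf {N : ℕ∞ | ∃ m : ℕ, N = m + 1 ∧ ∃ (Xm : PtTop.{u}) (ιm : PtMap A Xm) (ιn : PtMap A X)
    (ζ : PtMap S X), R.IsHcatChain m ιm ∧ R.IsHcatStep ιm ιn ζ ∧ PtHomotopic ζ f}

end RelSuspension

open CategoryTheory

/-!
# The relative category of a map out of a relative suspension

Pointed spaces, pointed maps and homotopies of homotopies form a strict 2-category with invertible
2-cells: the maps from `X` to `T` are a groupoid whose morphisms, the *cells*, are the classes of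
homotopies, with whiskering `k ◁ φ` and `φ ▷ k` and the interchange law `PtMap.exchange`. A homotopy
pushout is characterized in this 2-category as a *weak pushout* (`isHomotopyPushout_iff`): squares
factor through it, and compatible cells on the two sides extend to its vertex, without any uniqueness
of the extension. This needs only one computation with double mapping cylinders
(`DMC.isWeakPushout`). Weak pushouts paste (`IsWeakPushout.paste_left`), and if the first and the
composite of two adjacent squares are weak pushouts, so is the second
(`IsWeakPushout.of_paste_left`).

*Relative category.* The map `θ : A → S` induces maps `Φ` from the Ganea construction of `f ∘ θ` to that
of `f`, over `X` (`MapFactor.Hom.ganea`). The map `ω` becomes homotopic to the structure map `α` of the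
Ganea construction of `f` under `Φ` (`RelSuspension.homotopic_omegaDMC`): the map from `W` to the
homotopy pullback that is used in `ω` is carried by `Φ` to a map which is homotopic to the one that
factors through the diagonal section `S → F`, and along this section the glueing homotopy of the next
pushout joins its leg `S → G'` to the composite `S → G → G'` of the structure map of the term `G` before
with the other leg. Hence `σ` can be replaced by `Φ ∘ σ`.

*Strong relative category.* A chain of Hopf steps consists of spaces `Xi` under `A`, but a chain of
relative steps has to consist of spaces under `S`. The spaces `Xi` are therefore replaced by
`Xi ∪_A E`, where `E` is a space under `A` of which `S` is a retract; `S` maps to this space through its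
section `S → E`, and a section over `S` is what a relative step asks for.

* At each step but the last, `A ← Z → Xi` is replaced by `S ← Z ∨ S → Xi ∪_A E`, where `Z → S`
  factors through `A`. The pushout has again the form `Xj ∪_A E'`, where `E'` arises from `E` by
  glueing, and it has the section over `S` that the wedge summand `S` provides
  (`exists_isRelcatStep`). Only the homotopy between the composite `A → Xi → Xj` and the next map
  `A → Xj` is used.
* At the last step, `Xj` has to come with the map `ζ : S → Xj` itself. Put `Z' = Z ∪_W A`. Since `S` is
  the pushout of `A ← W → A`, it is the pushout of `A ← Z → Z'`, so that the pushout `Xj` of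
  `A ← Z → Xi` is that of `S ← Z' → Xi`, with leg `ζ`. Here the coherence of the cube enters: it provides
  the cell over `Z'`. Hence `Xj` is the pushout of `S ← Z' ∪_A E → Xi ∪_A E`, and the left map has
  the section `S → E` (`RelSuspension.IsHcatStep.isRelcatStep`).

The number of steps is unchanged, and the chain begins with a homotopy equivalence because `X₀ ∪_A S`
is equivalent to `S` when `A → X₀` is an equivalence.
-/

/-! ### Homotopies of homotopies -/

namespace PtHomotopy

variable {X Y Z T : PtTop.{u}}

/-- The retraction of the real line onto the unit interval. -/
noncomputable abbrev clamp (r : ℝ) : I := Set.projIcc 0 1 zero_le_one r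

/-- The values of a composite homotopy. The two branches are written with `clamp`, so that their
arguments need no proof of membership in the unit interval. -/
theorem trans_apply {f g h : PtMap X T} (H : PtHomotopy f g) (K : PtHomotopy g h) (t : I) (x : X) :
    H.trans K (t, x) =
      if (t : ℝ) ≤ 1 / 2 then H (clamp (2 * t), x) else K (clamp (2 * t - 1), x) := by
  rw [ContinuousMap.HomotopyRel.trans_apply]
  dsimp only
  have h0 := t.2.1
  have h1 := t.2.2
  split_ifs with h
  · rw [clamp, Set.projIcc_of_mem _ ⟨by linarith, by linarith⟩]
  · rw [clamp, Set.projIcc_of_mem _ ⟨by linarith, by linarith⟩]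

theorem symm_apply {f g : PtMap X T} (H : PtHomotopy f g) (t : I) (x : X) :
    H.symm (t, x) = H (σ t, x) := rfl

/-- The point dividing the segment from `a` to `b` in the ratio `s`. -/
def segment (s a b : I) : I :=
  ⟨(1 - s) * a + s * b, by
    have := s.2.1; have := s.2.2
    have := a.2.1; have := a.2.2
    have := b.2.1; have := b.2.2
    constructor <;> nlinarith⟩

theorem continuous_segment : Continuous fun q : I × I × I => segment q.1 q.2.1 q.2.2 := by
  unfold segment
  fun_prop

theorem segment_zero (a b : I) : segment 0 a b = a := by
  ext; simp [segment]

theorem segment_one (a b : I) : segment 1 a b = b := by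
  ext; simp [segment]

theorem segment_self (s a : I) : segment s a a = a := by
  ext; simp [segment]; ring

/-- Two homotopies swept out by the same two-parameter family of maps, along paths in the square of
parameters with the same end points, are equivalent, because the square is convex. -/
theorem Equivalent.of_square {f g : PtMap X T} {H K : PtHomotopy f g} (G : (I × I) × X → T)
    (hG : Continuous G) (hpt : ∀ d, G (d, X.pt) = T.pt) (γ δ : I → I × I)
    (hγ : Continuous γ) (hδ : Continuous δ) (h0 : γ 0 = δ 0) (h1 : γ 1 = δ 1)
    (hH : ∀ t x, H (t, x) = G (γ t, x)) (hK : ∀ t x, K (t, x) = G (δ t, x)) :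
    Equivalent H K := by
  refine ⟨{
    toFun := fun q => G ((segment q.1 (γ q.2.1).1 (δ q.2.1).1,
      segment q.1 (γ q.2.1).2 (δ q.2.1).2), q.2.2)
    continuous_toFun := ?_
    map_zero_left := ?_
    map_one_left := ?_
    prop' := ?_ }⟩
  · refine hG.comp (Continuous.prodMk (Continuous.prodMk ?_ ?_) (by fun_prop))
    · exact continuous_segment.comp (f := fun q : I × I × X => (q.1, (γ q.2.1).1, (δ q.2.1).1))
        (by fun_prop)
    · exact continuous_segment.comp (f := fun q : I × I × X => (q.1, (γ q.2.1).2, (δ q.2.1).2))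
        (by fun_prop)
  · rintro ⟨t, x⟩
    simp only [segment_zero]
    exact (hH t x).symm
  · rintro ⟨t, x⟩
    simp only [segment_one]
    exact (hK t x).symm
  · rintro s ⟨t, x⟩ (rfl | rfl | rfl)
    · simp only [ContinuousMap.coe_mk, h0, segment_self]
      exact ((hH 0 x).trans (by rw [h0])).symm
    · simp only [ContinuousMap.coe_mk, h1, segment_self]
      exact ((hH 1 x).trans (by rw [h1])).symm
    · simp only [ContinuousMap.coe_mk, hpt]
      exact ((hH t _).trans (hpt _)).symm

theorem Equivalent.of_eq {f g : PtMap X T} {H K : PtHomotopy f g}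
    (h : ∀ t x, H (t, x) = K (t, x)) : Equivalent H K := by
  have : H = K := ContinuousMap.HomotopyWith.ext fun q => h q.1 q.2
  subst this
  exact ContinuousMap.HomotopicRel.refl _

theorem Equivalent.symm_congr {f g : PtMap X T} {H K : PtHomotopy f g} (h : Equivalent H K) :
    Equivalent (f := g) (g := f) H.symm K.symm := by
  obtain ⟨Φ⟩ := h
  refine ⟨{
    toFun := fun q => Φ (q.1, σ q.2.1, q.2.2)
    continuous_toFun := by fun_prop
    map_zero_left := fun q => Φ.map_zero_left (σ q.1, q.2)
    map_one_left := fun q => Φ.map_one_left (σ q.1, q.2)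
    prop' := ?_ }⟩
  rintro s ⟨t, x⟩ h
  refine Φ.prop s (σ t, x) ?_
  rcases h with rfl | rfl | rfl
  · exact .inr (.inl symm_zero)
  · exact .inl symm_one
  · exact .inr (.inr rfl)

theorem Equivalent.trans_congr {f g h : PtMap X T} {H H' : PtHomotopy f g} {K K' : PtHomotopy g h}
    (h₁ : Equivalent H H') (h₂ : Equivalent K K') :
    Equivalent (f := f) (g := h) (H.trans K) (H'.trans K') := by
  obtain ⟨Φ⟩ := h₁
  obtain ⟨Ψ⟩ := h₂
  -- The two homotopies of homotopies, with the roles of the two parameters exchanged.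
  let A : (f.toMap.comp (ContinuousMap.snd (α := I))).Homotopy
      (g.toMap.comp (ContinuousMap.snd (α := I))) :=
    { toFun := fun q => Φ (q.2.1, q.1, q.2.2)
      continuous_toFun := by fun_prop
      map_zero_left := fun q => (Φ.prop q.1 (0, q.2) (.inl rfl)).trans (H.map_zero_left q.2)
      map_one_left := fun q => (Φ.prop q.1 (1, q.2) (.inr (.inl rfl))).trans (H.map_one_left q.2) }
  let B : (g.toMap.comp (ContinuousMap.snd (α := I))).Homotopy
      (h.toMap.comp (ContinuousMap.snd (α := I))) :=
    { toFun := fun q => Ψ (q.2.1, q.1, q.2.2)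
      continuous_toFun := by fun_prop
      map_zero_left := fun q => (Ψ.prop q.1 (0, q.2) (.inl rfl)).trans (K.map_zero_left q.2)
      map_one_left := fun q => (Ψ.prop q.1 (1, q.2) (.inr (.inl rfl))).trans (K.map_one_left q.2) }
  have hAB : ∀ s t x, A.trans B (t, (s, x)) = if (t : ℝ) ≤ 1 / 2 then Φ (s, clamp (2 * t), x)
      else Ψ (s, clamp (2 * t - 1), x) := by
    intro s t x
    rw [ContinuousMap.Homotopy.trans_apply]
    have h0 := t.2.1
    have h1 := t.2.2
    split_ifs with h
    · rw [clamp, Set.projIcc_of_mem _ ⟨by linarith, by linarith⟩]; rfl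
    · rw [clamp, Set.projIcc_of_mem _ ⟨by linarith, by linarith⟩]; rfl
  refine ⟨{
    toFun := fun q => A.trans B (q.2.1, (q.1, q.2.2))
    continuous_toFun := by fun_prop
    map_zero_left := ?_
    map_one_left := ?_
    prop' := ?_ }⟩
  · rintro ⟨t, x⟩
    rw [hAB]
    refine Eq.trans ?_ (trans_apply H K t x).symm
    split_ifs
    · exact Φ.map_zero_left _
    · exact Ψ.map_zero_left _
  · rintro ⟨t, x⟩
    rw [hAB]
    refine Eq.trans ?_ (trans_apply H' K' t x).symm
    split_ifs
    · exact Φ.map_one_left _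
    · exact Ψ.map_one_left _
  · rintro s ⟨t, x⟩ hq
    rcases hq with rfl | rfl | rfl
    · exact ((A.trans B).map_zero_left (s, x)).trans ((H.trans K).map_zero_left x).symm
    · exact ((A.trans B).map_one_left (s, x)).trans ((H.trans K).map_one_left x).symm
    · refine (hAB s t _).trans (Eq.trans ?_ (trans_apply H K t _).symm)
      split_ifs
      · exact Φ.prop s _ (.inr (.inr rfl))
      · exact Ψ.prop s _ (.inr (.inr rfl))

theorem Equivalent.post_congr {f g : PtMap X Y} {H K : PtHomotopy f g} (h : Equivalent H K)
    (k : PtMap Y T) : Equivalent (post H k) (post K k) := by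
  obtain ⟨Φ⟩ := h
  exact ⟨{
    toFun := fun q => k (Φ q)
    continuous_toFun := k.toMap.continuous.comp Φ.continuous
    map_zero_left := fun q => congrArg k (Φ.map_zero_left q)
    map_one_left := fun q => congrArg k (Φ.map_one_left q)
    prop' := fun s q hq => congrArg k (Φ.prop s q hq) }⟩

theorem Equivalent.pre_congr {f g : PtMap Y T} {H K : PtHomotopy f g} (h : Equivalent H K)
    (k : PtMap X Y) : Equivalent (pre H k) (pre K k) := by
  obtain ⟨Φ⟩ := h
  refine ⟨{
    toFun := fun q => Φ (q.1, q.2.1, k q.2.2)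
    continuous_toFun := Φ.continuous.comp
      (continuous_fst.prodMk ((by fun_prop : Continuous fun q : I × I × X => q.2.1).prodMk
        (k.toMap.continuous.comp (by fun_prop))))
    map_zero_left := fun q => Φ.map_zero_left (q.1, k q.2)
    map_one_left := fun q => Φ.map_one_left (q.1, k q.2)
    prop' := ?_ }⟩
  rintro s ⟨t, x⟩ hq
  refine Φ.prop s (t, k x) ?_
  rcases hq with rfl | rfl | rfl
  · exact .inl rfl
  · exact .inr (.inl rfl)
  · exact .inr (.inr k.map_pt)

theorem apply_pt {f g : PtMap X T} (H : PtHomotopy f g) (t : I) : H (t, X.pt) = T.pt :=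
  (H.prop t _ rfl).trans f.map_pt

theorem continuous_clamp {α : Type*} [TopologicalSpace α] {r : α → ℝ} (h : Continuous r) :
    Continuous fun a => clamp (r a) :=
  continuous_projIcc.comp h

theorem clamp_of_nonpos {r : ℝ} (h : r ≤ 0) : clamp r = 0 := Set.projIcc_of_le_left _ h

theorem clamp_of_one_le {r : ℝ} (h : 1 ≤ r) : clamp r = 1 := Set.projIcc_of_right_le _ h

theorem clamp_coe (t : I) : clamp t = t := Set.projIcc_val _ t

theorem coe_clamp {r : ℝ} (h0 : 0 ≤ r) (h1 : r ≤ 1) : (clamp r : ℝ) = r := by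
  rw [clamp, Set.projIcc_of_mem _ ⟨h0, h1⟩]

/-- A homotopy and a reparametrization of it are equivalent. -/
theorem Equivalent.of_reparam {f f' g g' : PtMap X T} {H K : PtHomotopy f g}
    (G : PtHomotopy f' g') (γ δ : I → ℝ) (hγ : Continuous γ) (hδ : Continuous δ)
    (h0 : clamp (γ 0) = clamp (δ 0)) (h1 : clamp (γ 1) = clamp (δ 1))
    (hH : ∀ t x, H (t, x) = G (clamp (γ t), x)) (hK : ∀ t x, K (t, x) = G (clamp (δ t), x)) :
    Equivalent H K :=
  Equivalent.of_square (fun q => G (q.1.1, q.2)) (by fun_prop) (fun d => apply_pt G d.1)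
    (fun t => (clamp (γ t), 0)) (fun t => (clamp (δ t), 0))
    ((continuous_clamp hγ).prodMk continuous_const)
    ((continuous_clamp hδ).prodMk continuous_const)
    (by rw [h0]) (by rw [h1]) hH hK

theorem Equivalent.refl_trans {f g : PtMap X T} (H : PtHomotopy f g) :
    Equivalent (f := f) (g := g)
      ((ContinuousMap.HomotopyRel.refl f.toMap {X.pt}).trans H) H := by
  refine Equivalent.of_reparam H (fun t => 2 * t - 1) (fun t => t) (by fun_prop) (by fun_prop)
    ?_ ?_ ?_ ?_
  · simp [clamp_of_nonpos]
  · norm_num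
  · intro t x
    rw [trans_apply]
    split_ifs with h
    · rw [clamp_of_nonpos (r := 2 * t - 1) (by linarith)]
      exact (H.map_zero_left x).symm
    · rfl
  · intro t x
    rw [clamp_coe]

theorem Equivalent.trans_refl {f g : PtMap X T} (H : PtHomotopy f g) :
    Equivalent (f := f) (g := g)
      (H.trans (ContinuousMap.HomotopyRel.refl g.toMap {X.pt})) H := by
  refine Equivalent.of_reparam H (fun t => 2 * t) (fun t => t) (by fun_prop) (by fun_prop)
    ?_ ?_ ?_ ?_
  · simp
  · simp [clamp_of_one_le]
  · intro t x
    rw [trans_apply]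
    split_ifs with h
    · rfl
    · rw [clamp_of_one_le (r := 2 * t) (by linarith)]
      exact (H.map_one_left x).symm
  · intro t x
    rw [clamp_coe]

theorem Equivalent.trans_symm {f g : PtMap X T} (H : PtHomotopy f g) :
    Equivalent (f := f) (g := f)
      (H.trans H.symm) (ContinuousMap.HomotopyRel.refl f.toMap {X.pt}) := by
  refine Equivalent.of_reparam H (fun t => min (2 * t) (2 - 2 * t)) (fun t => 0) (by fun_prop)
    (by fun_prop) ?_ ?_ ?_ ?_
  · simp
  · simp
  · intro t x
    have h1 := t.2.2
    rw [trans_apply]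
    split_ifs with h
    · rw [min_eq_left (by linarith)]
    · rw [min_eq_right (by linarith), symm_apply]
      congr 2
      ext
      rw [coe_symm_eq, coe_clamp (by linarith) (by linarith),
        coe_clamp (by linarith) (by linarith)]
      ring
  · intro t x
    rw [clamp_of_nonpos le_rfl]
    exact (H.map_zero_left x).symm

theorem Equivalent.trans_assoc {f g h k : PtMap X T} (H : PtHomotopy f g) (K : PtHomotopy g h)
    (L : PtHomotopy h k) :
    Equivalent (f := f) (g := k) ((H.trans K).trans L) (H.trans (K.trans L)) := by
  refine Equivalent.of_reparam (f' := f) (g' := k) (H.trans (K.trans L))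
    (fun t => min (2 * t) (min (t + 1 / 4) ((t + 1) / 2))) (fun t => t) (by fun_prop) (by fun_prop)
    ?_ ?_ ?_ ?_
  · norm_num
  · norm_num
  · intro t x
    have h0 := t.2.1
    have h1 := t.2.2
    rw [trans_apply (f := f) (g := h) (h := k) (H.trans K) L,
      trans_apply (f := f) (g := g) (h := k) H (K.trans L),
      trans_apply (f := f) (g := g) (h := h), trans_apply (f := g) (g := h) (h := k)]
    by_cases h2 : (t : ℝ) ≤ 1 / 2
    · rw [if_pos h2, coe_clamp (by linarith) (by linarith), min_eq_left (b := ((t : ℝ) + 1) / 2)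
        (by linarith)]
      by_cases h4 : (t : ℝ) ≤ 1 / 4
      · rw [if_pos (by linarith), min_eq_left (by linarith), coe_clamp (by linarith) (by linarith),
          if_pos (by linarith)]
      · rw [if_neg (by linarith), min_eq_right (by linarith), coe_clamp (by linarith) (by linarith),
          if_neg (by linarith), coe_clamp (by linarith) (by linarith), if_pos (by linarith)]
        congr 3
        ring
    · rw [if_neg h2, min_eq_right (a := (t : ℝ) + 1 / 4) (by linarith), min_eq_right (by linarith),
        coe_clamp (by linarith) (by linarith), if_neg (by linarith),
        coe_clamp (by linarith) (by linarith), if_neg (by linarith)]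
      congr 3
      ring
  · intro t x
    rw [clamp_coe]

/-- The two ways of composing homotopies `H : f ≃ f'` and `K : g ≃ g'` into a homotopy from `g ∘ f` to
`g' ∘ f'`: they run along two sides of the square `(s, t) ↦ K t ∘ H s`. -/
theorem Equivalent.interchange {f f' : PtMap X Y} {g g' : PtMap Y T} (H : PtHomotopy f f')
    (K : PtHomotopy g g') :
    Equivalent (f := g.comp f) (g := g'.comp f') ((post H g).trans (pre K f'))
      ((pre K f).trans (post H g')) := by
  refine Equivalent.of_square (fun q => K (q.1.2, H (q.1.1, q.2))) (by fun_prop)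
    (fun d => (congrArg (fun y => K (d.2, y)) (apply_pt H d.1)).trans (apply_pt K d.2))
    (fun t => (clamp (2 * t), clamp (2 * t - 1))) (fun t => (clamp (2 * t - 1), clamp (2 * t)))
    ((continuous_clamp (by fun_prop)).prodMk (continuous_clamp (by fun_prop)))
    ((continuous_clamp (by fun_prop)).prodMk (continuous_clamp (by fun_prop)))
    ?_ ?_ ?_ ?_
  · simp [clamp_of_nonpos]
  · norm_num [clamp_of_one_le]
  · intro t x
    rw [trans_apply (f := g.comp f) (g := g.comp f') (h := g'.comp f')]
    split_ifs with h
    · rw [clamp_of_nonpos (r := 2 * t - 1) (by linarith)]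
      exact (K.map_zero_left _).symm
    · rw [clamp_of_one_le (r := 2 * t) (by linarith)]
      exact congrArg (fun y => K (_, y)) (H.map_one_left x).symm
  · intro t x
    rw [trans_apply (f := g.comp f) (g := g'.comp f) (h := g'.comp f')]
    split_ifs with h
    · rw [clamp_of_nonpos (r := 2 * t - 1) (by linarith)]
      exact congrArg (fun y => K (_, y)) (H.map_zero_left x).symm
    · rw [clamp_of_one_le (r := 2 * t) (by linarith)]
      exact (K.map_one_left _).symm

end PtHomotopy

/-! ### The 2-category of pointed spaces -/

namespace PtMap

variable {X Y Z T : PtTop.{u}}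

/-- Equivalence of homotopies, as a setoid. -/
def homotopySetoid (f g : PtMap X T) : Setoid (PtHomotopy f g) where
  r := PtHomotopy.Equivalent
  iseqv := ContinuousMap.HomotopicRel.equivalence.comap _

/-- The pointed maps from `X` to `T` form a groupoid, in which a morphism (a *cell*) from `f` to `g`
is an equivalence class of pointed homotopies from `f` to `g`. -/
noncomputable instance : Groupoid (PtMap X T) where
  Hom f g := Quotient (homotopySetoid f g)
  id f := Quotient.mk _ (ContinuousMap.HomotopyRel.refl f.toMap {X.pt})
  comp := Quotient.map₂ (fun H K => H.trans K) fun _ _ h _ _ h' => h.trans_congr h'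
  inv := Quotient.map (fun H => H.symm) fun _ _ h => h.symm_congr
  id_comp := by
    rintro f g ⟨H⟩
    exact Quotient.sound (PtHomotopy.Equivalent.refl_trans H)
  comp_id := by
    rintro f g ⟨H⟩
    exact Quotient.sound (PtHomotopy.Equivalent.trans_refl H)
  assoc := by
    rintro f g h k ⟨H⟩ ⟨K⟩ ⟨L⟩
    exact Quotient.sound (PtHomotopy.Equivalent.trans_assoc H K L)
  inv_comp := by
    rintro f g ⟨H⟩
    refine Quotient.sound ?_
    have := PtHomotopy.Equivalent.trans_symm (f := g) (g := f) H.symm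
    rwa [ContinuousMap.HomotopyRel.symm_symm] at this
  comp_inv := by
    rintro f g ⟨H⟩
    exact Quotient.sound (PtHomotopy.Equivalent.trans_symm H)

/-- The cell represented by a homotopy. -/
def cell {f g : PtMap X T} (H : PtHomotopy f g) : f ⟶ g := Quotient.mk (homotopySetoid f g) H

theorem cell_surjective {f g : PtMap X T} (φ : f ⟶ g) : ∃ H : PtHomotopy f g, cell H = φ :=
  Quotient.exists_rep φ

theorem cell_eq_cell {f g : PtMap X T} {H K : PtHomotopy f g} :
    cell H = cell K ↔ PtHomotopy.Equivalent H K :=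
  ⟨fun h => Quotient.exact h, fun h => Quotient.sound h⟩

theorem cell_symm {f g : PtMap X T} (H : PtHomotopy f g) :
    cell (f := g) (g := f) H.symm = inv (cell H) := by
  rw [← Groupoid.inv_eq_inv]
  rfl

theorem nonempty_cell {f g : PtMap X T} : Nonempty (f ⟶ g) ↔ PtHomotopic f g :=
  ⟨fun ⟨φ⟩ => ⟨(cell_surjective φ).choose⟩, fun ⟨H⟩ => ⟨cell H⟩⟩

/-- Whiskering of a cell with a map on the left. -/
def whiskerL (k : PtMap Y T) {f g : PtMap X Y} (φ : f ⟶ g) : k.comp f ⟶ k.comp g :=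
  Quotient.map (sa := homotopySetoid f g) (sb := homotopySetoid (k.comp f) (k.comp g))
    (fun H => PtHomotopy.post H k) (fun _ _ h => h.post_congr k) φ

/-- Whiskering of a cell with a map on the right. -/
def whiskerR {f g : PtMap Y T} (φ : f ⟶ g) (k : PtMap X Y) : f.comp k ⟶ g.comp k :=
  Quotient.map (sa := homotopySetoid f g) (sb := homotopySetoid (f.comp k) (g.comp k))
    (fun H => PtHomotopy.pre H k) (fun _ _ h => h.pre_congr k) φ

end PtMap

infixr:81 " ◁ " => PtMap.whiskerL
infixl:81 " ▷ " => PtMap.whiskerR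

namespace PtMap

variable {X Y Z T : PtTop.{u}}

theorem whiskerL_id (k : PtMap Y T) (f : PtMap X Y) : k ◁ 𝟙 f = 𝟙 (k.comp f) := rfl

theorem id_whiskerR (f : PtMap Y T) (k : PtMap X Y) : 𝟙 f ▷ k = 𝟙 (f.comp k) := rfl

theorem whiskerL_comp (k : PtMap Y T) {f g h : PtMap X Y} (φ : f ⟶ g) (τ : g ⟶ h) :
    k ◁ (φ ≫ τ) = k ◁ φ ≫ k ◁ τ := by
  obtain ⟨H, rfl⟩ := cell_surjective φ
  obtain ⟨K, rfl⟩ := cell_surjective τ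
  refine cell_eq_cell.2 (PtHomotopy.Equivalent.of_eq fun t x => ?_)
  refine (congrArg k (PtHomotopy.trans_apply H K t x)).trans (Eq.trans ?_
    (PtHomotopy.trans_apply (PtHomotopy.post H k) (PtHomotopy.post K k) t x).symm)
  exact apply_ite k _ _ _

theorem comp_whiskerR {f g h : PtMap Y T} (φ : f ⟶ g) (τ : g ⟶ h) (k : PtMap X Y) :
    (φ ≫ τ) ▷ k = φ ▷ k ≫ τ ▷ k := by
  obtain ⟨H, rfl⟩ := cell_surjective φ
  obtain ⟨K, rfl⟩ := cell_surjective τ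
  refine cell_eq_cell.2 (PtHomotopy.Equivalent.of_eq fun t x => ?_)
  exact (PtHomotopy.trans_apply H K t (k x)).trans
    (PtHomotopy.trans_apply (PtHomotopy.pre H k) (PtHomotopy.pre K k) t x).symm

/-- Whiskering on the left, as a functor. -/
noncomputable def postFunctor (k : PtMap Y T) : PtMap X Y ⥤ PtMap X T where
  obj f := k.comp f
  map φ := k ◁ φ
  map_id := whiskerL_id k
  map_comp := whiskerL_comp k

/-- Whiskering on the right, as a functor. -/
noncomputable def preFunctor (k : PtMap X Y) : PtMap Y T ⥤ PtMap X T where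
  obj f := f.comp k
  map φ := φ ▷ k
  map_id f := id_whiskerR f k
  map_comp φ τ := comp_whiskerR φ τ k

theorem whiskerL_inv (k : PtMap Y T) {f g : PtMap X Y} (φ : f ⟶ g) :
    k ◁ inv φ = inv (k ◁ φ) :=
  (postFunctor k).map_inv φ

theorem inv_whiskerR {f g : PtMap Y T} (φ : f ⟶ g) (k : PtMap X Y) :
    inv φ ▷ k = inv (φ ▷ k) :=
  (preFunctor k).map_inv φ

theorem comp_whiskerL (k : PtMap Z T) (l : PtMap Y Z) {f g : PtMap X Y} (φ : f ⟶ g) :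
    k.comp l ◁ φ = k ◁ l ◁ φ := by
  obtain ⟨H, rfl⟩ := cell_surjective φ
  rfl

theorem whiskerR_comp {f g : PtMap Z T} (φ : f ⟶ g) (k : PtMap Y Z) (l : PtMap X Y) :
    φ ▷ k.comp l = φ ▷ k ▷ l := by
  obtain ⟨H, rfl⟩ := cell_surjective φ
  rfl

theorem whiskerL_whiskerR (k : PtMap Z T) {f g : PtMap Y Z} (φ : f ⟶ g) (l : PtMap X Y) :
    (k ◁ φ) ▷ l = k ◁ (φ ▷ l) := by
  obtain ⟨H, rfl⟩ := cell_surjective φ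
  rfl

theorem id_whiskerL {f g : PtMap X Y} (φ : f ⟶ g) : PtMap.id Y ◁ φ = φ := by
  obtain ⟨H, rfl⟩ := cell_surjective φ
  rfl

theorem whiskerR_id {f g : PtMap X Y} (φ : f ⟶ g) : φ ▷ PtMap.id X = φ := by
  obtain ⟨H, rfl⟩ := cell_surjective φ
  rfl

/-- The interchange law. -/
theorem exchange {f f' : PtMap X Y} {g g' : PtMap Y T} (φ : f ⟶ f') (τ : g ⟶ g') :
    g ◁ φ ≫ τ ▷ f' = τ ▷ f ≫ g' ◁ φ := by
  obtain ⟨H, rfl⟩ := cell_surjective φ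
  obtain ⟨K, rfl⟩ := cell_surjective τ
  exact cell_eq_cell.2 (PtHomotopy.Equivalent.interchange H K)

/-- A pointed homotopy equivalence `e` induces equivalences `u ↦ u ∘ e` of groupoids of maps. -/
theorem IsHomotopyEquiv.isEquivalence_preFunctor {e : PtMap X Y} (he : e.IsHomotopyEquiv)
    (T : PtTop.{u}) : (preFunctor e : PtMap Y T ⥤ PtMap X T).IsEquivalence := by
  obtain ⟨e', ⟨H⟩, ⟨K⟩⟩ := he
  let F : PtMap Y T ≌ PtMap X T := CategoryTheory.Equivalence.mk (preFunctor e) (preFunctor e')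
    (NatIso.ofComponents (fun u => (Groupoid.isoEquivHom _ _).symm (u ◁ inv (cell K)))
      fun φ => by
        have h := exchange (inv (cell K)) φ
        rw [whiskerR_id, whiskerR_comp] at h
        exact h.symm)
    (NatIso.ofComponents (fun u => (Groupoid.isoEquivHom _ _).symm (u ◁ cell H))
      fun φ => by
        have h := exchange (cell H) φ
        rw [whiskerR_id, whiskerR_comp] at h
        exact h.symm)
  exact F.isEquivalence_functor

/-- Cells between maps restricted along a homotopy equivalence extend. -/
theorem IsHomotopyEquiv.exists_whiskerR_eq {e : PtMap X Y} (he : e.IsHomotopyEquiv)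
    {u v : PtMap Y T} (β : u.comp e ⟶ v.comp e) : ∃ δ : u ⟶ v, δ ▷ e = β := by
  have := he.isEquivalence_preFunctor T
  exact (preFunctor e).map_surjective β

end PtMap

/-! ### Weak pushouts -/

/-! Composition of pointed maps is associative and unital by definition, but the terms `(u ∘ a) ∘ f`
and `u ∘ (a ∘ f)` differ syntactically, which obstructs rewriting in the composites of cells below.
The local statements `key` therefore carry out the computations in an arbitrary groupoid, and are
applied up to definitional equality of the objects. For the same reason cells are replaced by
representing homotopies where their sources and targets have to be unfolded. -/

/-- A square `φ : a ∘ f ⟶ b ∘ g` in the 2-category of pointed spaces is a *weak pushout* if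
every other such square factors through it, up to compatible cells, and if two compatible cells on
the restrictions of two maps to `X` and to `Y` are induced by a cell between these maps. By
`isHomotopyPushout_iff` this is the same as a homotopy pushout. -/
structure IsWeakPushout {W X Y P : PtTop.{u}} (f : PtMap W X) (g : PtMap W Y) (a : PtMap X P)
    (b : PtMap Y P) (φ : a.comp f ⟶ b.comp g) : Prop where
  desc : ∀ {T : PtTop.{u}} (a' : PtMap X T) (b' : PtMap Y T) (τ : a'.comp f ⟶ b'.comp g),
    ∃ (u : PtMap P T) (α : u.comp a ⟶ a') (β : u.comp b ⟶ b'),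
      u ◁ φ ≫ β ▷ g = α ▷ f ≫ τ
  full : ∀ {T : PtTop.{u}} (u v : PtMap P T) (α : u.comp a ⟶ v.comp a)
    (β : u.comp b ⟶ v.comp b), u ◁ φ ≫ β ▷ g = α ▷ f ≫ v ◁ φ →
      ∃ δ : u ⟶ v, δ ▷ a = α ∧ δ ▷ b = β

namespace IsWeakPushout

open PtMap

variable {W X Y P P' : PtTop.{u}} {f : PtMap W X} {g : PtMap W Y} {a : PtMap X P} {b : PtMap Y P}
  {φ : a.comp f ⟶ b.comp g}

theorem congr_cell (h : IsWeakPushout f g a b φ) {ψ : a.comp f ⟶ b.comp g} (e : φ = ψ) :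
    IsWeakPushout f g a b ψ := e ▸ h

theorem symm (h : IsWeakPushout f g a b φ) : IsWeakPushout g f b a (inv φ) where
  desc a' b' τ := by
    obtain ⟨u, α, β, e⟩ := h.desc b' a' (inv τ)
    refine ⟨u, β, α, ?_⟩
    rw [whiskerL_inv]
    have key {C : Type u} [Groupoid.{u} C] {A B D E : C} {p : A ⟶ B} {q : B ⟶ E} {r : A ⟶ D}
        {s : E ⟶ D} (h : p ≫ q = r ≫ inv s) : inv p ≫ r = q ≫ s := by
      rw [IsIso.inv_comp_eq, ← Category.assoc, h]; simp
    exact key e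
  full u v α β e := by
    rw [whiskerL_inv, whiskerL_inv] at e
    have key {C : Type u} [Groupoid.{u} C] {A B D E : C} {p : A ⟶ B} {q : B ⟶ E} {r : A ⟶ D}
        {s : D ⟶ E} (h : inv p ≫ r = q ≫ inv s) : p ≫ q = r ≫ s := by
      rw [IsIso.inv_comp_eq, ← Category.assoc, IsIso.eq_comp_inv] at h; exact h.symm
    obtain ⟨δ, h1, h2⟩ := h.full u v β α (key e)
    exact ⟨δ, h2, h1⟩

/-- A weak pushout remains one when its vertex is replaced along a homotopy equivalence. -/
theorem of_equiv (h : IsWeakPushout f g a b φ) {e : PtMap P P'} (he : e.IsHomotopyEquiv) :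
    IsWeakPushout f g (e.comp a) (e.comp b) (e ◁ φ) where
  desc a' b' τ := by
    obtain ⟨u, α, β, hu⟩ := h.desc a' b' τ
    obtain ⟨e', ⟨H⟩, -⟩ := he
    obtain ⟨Φ, rfl⟩ := cell_surjective φ
    have h' := (whiskerL_comp u _ _).symm.trans
      ((congrArg (u ◁ ·) (exchange (cell Φ) (cell H))).trans (whiskerL_comp u _ _))
    refine ⟨u.comp e', u ◁ (cell H ▷ a) ≫ α, u ◁ (cell H ▷ b) ≫ β, ?_⟩
    have key {C : Type u} [Groupoid.{u} C] {A B D E F G : C} {p : A ⟶ B} {q : B ⟶ D} {b : D ⟶ E}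
        {r : A ⟶ F} {s : F ⟶ D} {a : F ⟶ G} {τ : G ⟶ E} {q' : B ⟶ E} {r' : A ⟶ G}
        (h : p ≫ q = r ≫ s) (h' : s ≫ b = a ≫ τ) (hq : q' = q ≫ b) (hr : r' = r ≫ a) :
        p ≫ q' = r' ≫ τ := by
      rw [hq, hr, Category.assoc, ← h', reassoc_of% h]
    exact key h' hu (comp_whiskerR _ _ _) (comp_whiskerR _ _ _)
  full u v α β h' := by
    obtain ⟨δ, h1, h2⟩ := h.full (u.comp e) (v.comp e) α β (by
      obtain ⟨Φ, rfl⟩ := cell_surjective φ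
      exact h')
    obtain ⟨ε, rfl⟩ := he.exists_whiskerR_eq δ
    exact ⟨ε, by rw [whiskerR_comp]; exact h1, by rw [whiskerR_comp]; exact h2⟩

/-- A weak pushout is unique up to homotopy equivalence. -/
theorem isHomotopyEquiv (h : IsWeakPushout f g a b φ) {e : PtMap P P'}
    (h' : IsWeakPushout f g (e.comp a) (e.comp b) (e ◁ φ)) : e.IsHomotopyEquiv := by
  obtain ⟨u, α, β, hu⟩ := h'.desc a b φ
  refine ⟨u, ?_, ?_⟩
  · obtain ⟨δ, -, -⟩ := h.full (u.comp e) (PtMap.id P) α β (by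
      rw [comp_whiskerL, id_whiskerL]; exact hu)
    exact nonempty_cell.1 ⟨δ⟩
  · obtain ⟨δ, -, -⟩ := h'.full (e.comp u) (PtMap.id P') (e ◁ α) (e ◁ β) (by
      obtain ⟨Φ, rfl⟩ := cell_surjective φ
      obtain ⟨Α, rfl⟩ := cell_surjective α
      obtain ⟨Β, rfl⟩ := cell_surjective β
      exact (whiskerL_comp e _ _).symm.trans
        ((congrArg (e ◁ ·) hu).trans (whiskerL_comp e _ _)))
    exact nonempty_cell.1 ⟨δ⟩

/-- The leg `a` of a weak pushout may be replaced by a homotopic map. -/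
theorem congr_leg (h : IsWeakPushout f g a b φ) {a₁ : PtMap X P} (ψ : a₁ ⟶ a) :
    IsWeakPushout f g a₁ b (ψ ▷ f ≫ φ) where
  desc a' b' τ := by
    obtain ⟨u, α, β, hu⟩ := h.desc a' b' τ
    refine ⟨u, u ◁ ψ ≫ α, β, ?_⟩
    simp only [whiskerL_comp, comp_whiskerR, whiskerL_whiskerR]
    have key {C : Type u} [Groupoid.{u} C] {A B D E F : C} {r : A ⟶ B} {p : B ⟶ D} {q : D ⟶ E}
        {a : B ⟶ F} {τ : F ⟶ E} (h : p ≫ q = a ≫ τ) : (r ≫ p) ≫ q = (r ≫ a) ≫ τ := by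
      simp [h]
    exact key hu
  full u v α β e := by
    have key₁ {C : Type u} [Groupoid.{u} C] {A B D E A' B' : C} {r : A ⟶ B} {p : B ⟶ D} {q : D ⟶ E}
        {a : A ⟶ A'} {r' : A' ⟶ B'} {p' : B' ⟶ E} (h : (r ≫ p) ≫ q = a ≫ r' ≫ p') :
        p ≫ q = (inv r ≫ a ≫ r') ≫ p' := by
      simp [← h]
    obtain ⟨δ, h1, h2⟩ := h.full u v (inv (u ◁ ψ) ≫ α ≫ v ◁ ψ) β (by
      simp only [whiskerL_comp, comp_whiskerR, inv_whiskerR, whiskerL_whiskerR] at e ⊢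
      exact key₁ e)
    refine ⟨δ, ?_, h2⟩
    have key₂ {C : Type u} [Groupoid.{u} C] {A B D E : C} {p : A ⟶ B} {q : B ⟶ D} {r a : A ⟶ E}
        {s : E ⟶ D} (h : p ≫ q = r ≫ s) (h' : q = inv p ≫ a ≫ s) : r = a := by
      rw [h', IsIso.hom_inv_id_assoc] at h
      exact ((cancel_mono s).1 h).symm
    exact key₂ (exchange ψ δ) h1

/-- The edge `f` of a weak pushout may be replaced by a homotopic map. -/
theorem congr_edge (h : IsWeakPushout f g a b φ) {f₁ : PtMap W X} (ψ : f₁ ⟶ f) :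
    IsWeakPushout f₁ g a b (a ◁ ψ ≫ φ) where
  desc a' b' τ := by
    obtain ⟨u, α, β, hu⟩ := h.desc a' b' (inv (a' ◁ ψ) ≫ τ)
    refine ⟨u, α, β, ?_⟩
    have h' := exchange ψ α
    rw [comp_whiskerL] at h'
    rw [whiskerL_comp]
    have key {C : Type u} [Groupoid.{u} C] {A B D E F G : C} {r : A ⟶ B} {p : B ⟶ D} {q : D ⟶ E}
        {a : B ⟶ F} {i : G ⟶ F} {τ : G ⟶ E} {c : A ⟶ G} (h : p ≫ q = a ≫ inv i ≫ τ)
        (h' : r ≫ a = c ≫ i) : (r ≫ p) ≫ q = c ≫ τ := by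
      rw [Category.assoc, h, reassoc_of% h']; simp
    exact key hu h'
  full u v α β e := by
    have h' := exchange ψ α
    rw [comp_whiskerL, comp_whiskerL] at h'
    rw [whiskerL_comp, whiskerL_comp] at e
    have key {C : Type u} [Groupoid.{u} C] {A B D E F G : C} {r : A ⟶ B} {p : B ⟶ D} {q : D ⟶ E}
        {a : B ⟶ F} {i : G ⟶ F} {p' : F ⟶ E} {c : A ⟶ G} (h : (r ≫ p) ≫ q = c ≫ i ≫ p')
        (h' : r ≫ a = c ≫ i) : p ≫ q = a ≫ p' := by
      rw [← cancel_epi r, ← Category.assoc, h, reassoc_of% h']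
    exact h.full u v α β (key e h')

/-- Two weak pushouts placed side by side, along the leg `a` of the first one, form a weak pushout. -/
theorem paste_left (h : IsWeakPushout f g a b φ) {X' Q : PtTop.{u}} {k : PtMap X X'} {c : PtMap X' Q}
    {d : PtMap P Q} {ψ : c.comp k ⟶ d.comp a} (h' : IsWeakPushout k a c d ψ) :
    IsWeakPushout (k.comp f) g c (d.comp b) (ψ ▷ f ≫ d ◁ φ) where
  desc a' b' τ := by
    obtain ⟨u₁, α₁, β₁, e₁⟩ := h.desc (a'.comp k) b' τ
    obtain ⟨u, α, δ, e₂⟩ := h'.desc a' u₁ (inv α₁)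
    refine ⟨u, α, δ ▷ b ≫ β₁, ?_⟩
    obtain ⟨Φ, rfl⟩ := cell_surjective φ
    obtain ⟨Ψ, rfl⟩ := cell_surjective ψ
    obtain ⟨Α, rfl⟩ := cell_surjective α
    obtain ⟨Δ, rfl⟩ := cell_surjective δ
    have e₃ := (comp_whiskerR _ _ _).symm.trans
      ((congrArg (· ▷ f) e₂).trans (comp_whiskerR _ _ _))
    have e₄ := exchange (cell Φ) (cell Δ)
    rw [inv_whiskerR] at e₃
    have key {C : Type u} [Groupoid.{u} C] {A B D E F G L : C} {x₁ : A ⟶ B} {x₂ : B ⟶ D}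
        {y₁ : D ⟶ E} {y₂ : E ⟶ F} {z : A ⟶ G} {s : G ⟶ F} {w : B ⟶ L} {p : L ⟶ G}
        {v : L ⟶ E} {x : A ⟶ D} {y : D ⟶ F} (h₁ : v ≫ y₂ = p ≫ s) (h₂ : x₁ ≫ w = z ≫ inv p)
        (h₃ : x₂ ≫ y₁ = w ≫ v) (hx : x = x₁ ≫ x₂) (hy : y = y₁ ≫ y₂) : x ≫ y = z ≫ s := by
      rw [hx, hy, Category.assoc, reassoc_of% h₃, h₁, reassoc_of% h₂, IsIso.inv_hom_id_assoc]
    exact key e₁ e₃ e₄ (whiskerL_comp _ _ _) (comp_whiskerR _ _ _)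
  full u v α β e := by
    obtain ⟨Φ, rfl⟩ := cell_surjective φ
    obtain ⟨Ψ, rfl⟩ := cell_surjective ψ
    obtain ⟨Α, rfl⟩ := cell_surjective α
    have key₁ {C : Type u} [Groupoid.{u} C] {A B D E A' B' : C} {r : A ⟶ B} {p : B ⟶ D} {q : D ⟶ E}
        {a : A ⟶ A'} {r' : A' ⟶ B'} {p' : B' ⟶ E} {x : A ⟶ D} {x' : A' ⟶ E} {i : B ⟶ B'}
        (h : x ≫ q = a ≫ x') (hx : x = r ≫ p) (hx' : x' = r' ≫ p') (hi : r ≫ i = a ≫ r') :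
        p ≫ q = i ≫ p' := by
      rw [← cancel_epi r, reassoc_of% hi, ← hx', ← h, hx, Category.assoc]
    -- The cell from `u ∘ d ∘ a` to `v ∘ d ∘ a` that corresponds to `α` on the edge `k`.
    obtain ⟨ρ, hρ⟩ : ∃ ρ : u.comp (d.comp a) ⟶ v.comp (d.comp a),
        u ◁ cell Ψ ≫ ρ = cell Α ▷ k ≫ v ◁ cell Ψ := by
      have key₂ {C : Type u} [Groupoid.{u} C] {A B D : C} (p : A ⟶ B) (q : A ⟶ D) :
          ∃ ρ : B ⟶ D, p ≫ ρ = q := ⟨inv p ≫ q, IsIso.hom_inv_id_assoc _ _⟩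
      exact key₂ (u ◁ cell Ψ) (cell Α ▷ k ≫ v ◁ cell Ψ)
    obtain ⟨Ρ, rfl⟩ := cell_surjective ρ
    obtain ⟨δ₁, h1, h2⟩ := h.full (u.comp d) (v.comp d) (cell Ρ) β
      (key₁ e (whiskerL_comp _ _ _) (whiskerL_comp _ _ _) ((comp_whiskerR _ _ _).symm.trans
        ((congrArg (· ▷ f) hρ).trans (comp_whiskerR _ _ _))))
    obtain ⟨δ, h3, h4⟩ := h'.full u v (cell Α) δ₁ (by rw [h1]; exact hρ)
    exact ⟨δ, h3, by rw [whiskerR_comp, h4]; exact h2⟩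

end IsWeakPushout

/-! ### Homotopy pushouts are weak pushouts -/

namespace PtHomotopy

variable {X T : PtTop.{u}}

theorem trans_apply_left {f g h : PtMap X T} (H : PtHomotopy f g) (K : PtHomotopy g h) (t : I)
    (x : X) : H.trans K (clamp (t / 2), x) = H (t, x) := by
  have h0 := t.2.1
  have h1 := t.2.2
  rw [trans_apply, coe_clamp (by linarith) (by linarith), if_pos (by linarith), mul_div_cancel₀ _
    (two_ne_zero), clamp_coe]

theorem trans_apply_right {f g h : PtMap X T} (H : PtHomotopy f g) (K : PtHomotopy g h) (t : I)
    (x : X) : H.trans K (clamp ((1 + t) / 2), x) = K (t, x) := by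
  have h0 := t.2.1
  have h1 := t.2.2
  have e : (2 : ℝ) * ((1 + t) / 2) - 1 = t := by ring
  rw [trans_apply, coe_clamp (by linarith) (by linarith), e, clamp_coe]
  split_ifs with h
  · obtain rfl : t = 0 := Subtype.ext (le_antisymm (by rw [Set.Icc.coe_zero]; linarith) h0)
    rw [clamp_of_one_le (by simp)]
    exact (H.map_one_left x).trans (K.map_zero_left x).symm
  · rfl

end PtHomotopy

namespace DMC

open PtMap

variable {W X Y T : PtTop.{u}} {f : PtMap W X} {g : PtMap W Y}

/-- A homotopy between two maps defined on a double mapping cylinder, assembled from homotopies on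
the two ends and on the cylinder. It is continuous because the unit interval is locally compact. -/
def homotopy {u v : PtMap (DMC f g) T} (α : PtHomotopy (u.comp (inl f g)) (v.comp (inl f g)))
    (β : PtHomotopy (u.comp (inr f g)) (v.comp (inr f g))) (Θ : I × I × W → T)
    (hΘ : Continuous Θ) (h0 : ∀ q, Θ (0, q) = u (glue f g q)) (h1 : ∀ q, Θ (1, q) = v (glue f g q))
    (hl : ∀ s w, Θ (s, 0, w) = α (s, f w)) (hr : ∀ s w, Θ (s, 1, w) = β (s, g w))
    (hpt : ∀ s t, Θ (s, t, W.pt) = T.pt) : PtHomotopy u v where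
  toFun q := Quot.lift (fun x => Sum.elim (fun x => α (q.1, x))
    (Sum.elim (fun p => Θ (q.1, p)) (fun y => β (q.1, y))) x) (by
      rintro _ _ (w | w | t)
      · exact hl q.1 w
      · exact hr q.1 w
      · exact (hpt q.1 t).trans (PtHomotopy.apply_pt α q.1).symm) q.2
  continuous_toFun := by
    refine isQuotientMap_quot_mk.continuous_lift_prod_right ?_
    -- The product of the unit interval with a sum is a sum of products.
    have h : Continuous fun x : X ⊕ (I × W) ⊕ Y => (Sum.elim
        (ContinuousMap.curry ⟨fun q : X × I => α (q.2, q.1), by fun_prop⟩)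
        (Sum.elim (ContinuousMap.curry ⟨fun q : (I × W) × I => Θ (q.2, q.1), by fun_prop⟩)
          (ContinuousMap.curry ⟨fun q : Y × I => β (q.2, q.1), by fun_prop⟩)) x : C(I, T)) :=
      (ContinuousMap.continuous _).sumElim
        ((ContinuousMap.continuous _).sumElim (ContinuousMap.continuous _))
    refine (ContinuousEval.continuous_eval.comp
      ((h.comp continuous_snd).prodMk continuous_fst)).congr ?_
    rintro ⟨s, x | q | y⟩ <;> rfl
  map_zero_left := by
    rintro ⟨x | q | y⟩
    · exact α.map_zero_left x
    · exact h0 q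
    · exact β.map_zero_left y
  map_one_left := by
    rintro ⟨x | q | y⟩
    · exact α.map_one_left x
    · exact h1 q
    · exact β.map_one_left y
  prop' := by
    rintro t x rfl
    exact α.prop t _ rfl

/-- The double mapping cylinder is a weak pushout. For a square of cells on the restrictions of `u`
and `v`, represented by an equivalence `Ξ` of two composite homotopies `G` and `G'`, the cell from `u`
to `v` is composed of three: one absorbs the cell on `Y` into the cylinder, one is given by `Ξ`, and
one releases the cell on `X` from the cylinder. -/
theorem isWeakPushout (f : PtMap W X) (g : PtMap W Y) :
    IsWeakPushout f g (inl f g) (inr f g) (cell (glue f g)) where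
  desc a' b' τ := by
    obtain ⟨H, rfl⟩ := cell_surjective τ
    exact ⟨desc a' b' H, 𝟙 a', 𝟙 b', (Category.comp_id (cell H)).trans
      (Category.id_comp (cell H)).symm⟩
  full := by
    intro T u v α β e
    obtain ⟨Α, rfl⟩ := cell_surjective α
    obtain ⟨Β, rfl⟩ := cell_surjective β
    let G : PtHomotopy ((u.comp (inl f g)).comp f) ((v.comp (inr f g)).comp g) :=
      (PtHomotopy.post (glue f g) u).trans (PtHomotopy.pre Β g)
    let G' : PtHomotopy ((u.comp (inl f g)).comp f) ((v.comp (inr f g)).comp g) :=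
      (PtHomotopy.pre Α f).trans (PtHomotopy.post (glue f g) v)
    obtain ⟨Ξ⟩ : PtHomotopy.Equivalent G G' := cell_eq_cell.1 e
    let r {S : PtTop.{u}} (k : PtMap S T) : PtHomotopy k k := ContinuousMap.HomotopyRel.refl _ _
    -- The two maps between `u` and `v` that agree with `u` on `X` and with `v` on `Y`.
    let u₁ := DMC.desc (u.comp (inl f g)) (v.comp (inr f g)) G
    let u₂ := DMC.desc (u.comp (inl f g)) (v.comp (inr f g)) G'
    let δ₁ : PtHomotopy u u₁ := homotopy (r _) Β
      (fun q => G (PtHomotopy.clamp (q.2.1 * ((1 + q.1) / 2)), q.2.2))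
      (G.continuous.comp ((PtHomotopy.continuous_clamp (by fun_prop)).prodMk (by fun_prop)))
      (by
        rintro ⟨t, w⟩
        refine Eq.trans ?_ (PtHomotopy.trans_apply_left (f := u.comp ((inl f g).comp f))
          (g := u.comp ((inr f g).comp g)) (PtHomotopy.post (glue f g) u) (PtHomotopy.pre Β g) t w)
        simp only [Set.Icc.coe_zero, add_zero, mul_one_div]
        rfl)
      (by
        rintro ⟨t, w⟩
        simp only [Set.Icc.coe_one, one_add_one_eq_two, div_self (two_ne_zero' ℝ), mul_one,
          PtHomotopy.clamp_coe]
        rfl)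
      (by
        intro s w
        simp only [Set.Icc.coe_zero, zero_mul, PtHomotopy.clamp_of_nonpos le_rfl]
        exact G.map_zero_left w)
      (by
        intro s w
        simp only [Set.Icc.coe_one, one_mul]
        exact PtHomotopy.trans_apply_right (f := u.comp ((inl f g).comp f))
          (g := u.comp ((inr f g).comp g)) (PtHomotopy.post (glue f g) u) (PtHomotopy.pre Β g) s w)
      (fun s t => PtHomotopy.apply_pt G _)
    let δ₂ : PtHomotopy u₁ u₂ := homotopy (r _) (r _) Ξ Ξ.continuous Ξ.map_zero_left
      Ξ.map_one_left (fun s w => (Ξ.prop s (0, w) (.inl rfl)).trans (G.map_zero_left w))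
      (fun s w => (Ξ.prop s (1, w) (.inr (.inl rfl))).trans (G.map_one_left w))
      (fun s t => (Ξ.prop s (t, W.pt) (.inr (.inr rfl))).trans (PtHomotopy.apply_pt G t))
    let δ₃ : PtHomotopy u₂ v := homotopy Α (r _)
      (fun q => G' (PtHomotopy.clamp (q.1 / 2 + q.2.1 * (1 - q.1 / 2)), q.2.2))
      (G'.continuous.comp ((PtHomotopy.continuous_clamp (by fun_prop)).prodMk (by fun_prop)))
      (by
        rintro ⟨t, w⟩
        simp only [Set.Icc.coe_zero, zero_div, sub_zero, mul_one, zero_add, PtHomotopy.clamp_coe]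
        rfl)
      (by
        rintro ⟨t, w⟩
        refine Eq.trans ?_ (PtHomotopy.trans_apply_right (f := u.comp ((inl f g).comp f))
          (g := v.comp ((inl f g).comp f)) (PtHomotopy.pre Α f) (PtHomotopy.post (glue f g) v) t w)
        have e : ((1 : I) : ℝ) / 2 + t * (1 - (1 : I) / 2) = (1 + t) / 2 := by
          rw [Set.Icc.coe_one]; ring
        simp only [e]
        rfl)
      (by
        intro s w
        simp only [Set.Icc.coe_zero, zero_mul, add_zero]
        exact PtHomotopy.trans_apply_left (f := u.comp ((inl f g).comp f))
          (g := v.comp ((inl f g).comp f)) (PtHomotopy.pre Α f) (PtHomotopy.post (glue f g) v) s w)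
      (by
        intro s w
        simp only [Set.Icc.coe_one, one_mul, add_sub_cancel, PtHomotopy.clamp_of_one_le le_rfl]
        exact G'.map_one_left w)
      (fun s t => PtHomotopy.apply_pt G' _)
    refine ⟨cell δ₁ ≫ cell δ₂ ≫ cell δ₃, ?_, ?_⟩
    · rw [comp_whiskerR, comp_whiskerR]
      exact (Category.id_comp (𝟙 (u.comp (inl f g)) ≫ cell Α)).trans (Category.id_comp _)
    · rw [comp_whiskerR, comp_whiskerR]
      exact (congrArg (cell Β ≫ ·) (Category.id_comp (𝟙 (v.comp (inr f g))))).trans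
        (Category.comp_id _)

end DMC

/-- Both directions compare the square with the double mapping cylinder: being a weak pushout is
invariant under homotopy equivalences and determines the vertex up to homotopy equivalence. -/
theorem isHomotopyPushout_iff {W X Y P : PtTop.{u}} {f : PtMap W X} {g : PtMap W Y}
    {a : PtMap X P} {b : PtMap Y P} {H : PtHomotopy (a.comp f) (b.comp g)} :
    IsHomotopyPushout f g a b H ↔ IsWeakPushout f g a b (PtMap.cell H) :=
  ⟨fun h => (DMC.isWeakPushout f g).of_equiv h,
    fun h => (DMC.isWeakPushout f g).isHomotopyEquiv (e := DMC.desc a b H) h⟩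

/-! ### Pasting of weak pushouts -/

namespace IsWeakPushout

open PtMap

variable {W X Y P X' Y' Q : PtTop.{u}} {f : PtMap W X} {g : PtMap W Y} {a : PtMap X P}
  {b : PtMap Y P} {φ : a.comp f ⟶ b.comp g}

/-- If the first and the composite of two squares placed side by side, along the leg `a` of the first
one, are weak pushouts, so is the second. Weak pushouts determine cells only up to a choice, so that
this cannot be checked on the universal property directly; instead, the second square is compared
with the double mapping cylinder, and `isHomotopyEquiv` applies to the composite squares. -/
theorem of_paste_left (h : IsWeakPushout f g a b φ) {k : PtMap X X'} {c : PtMap X' Q}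
    {d : PtMap P Q} {ψ : c.comp k ⟶ d.comp a}
    (h' : IsWeakPushout (k.comp f) g c (d.comp b) (ψ ▷ f ≫ d ◁ φ)) : IsWeakPushout k a c d ψ := by
  obtain ⟨Ψ, rfl⟩ := cell_surjective ψ
  obtain ⟨Φ, rfl⟩ := cell_surjective φ
  have hD := h.paste_left (DMC.isWeakPushout k a)
  refine (DMC.isWeakPushout k a).of_equiv (e := DMC.desc c d Ψ) (hD.isHomotopyEquiv ?_)
  exact h'.congr_cell
    (whiskerL_comp (DMC.desc c d Ψ) (cell (DMC.glue k a) ▷ f) (DMC.inr k a ◁ cell Φ)).symm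

/-- Two weak pushouts placed side by side, along the leg `b` of the first one, form a weak
pushout. -/
theorem paste_right (h : IsWeakPushout f g a b φ) {k : PtMap Y Y'} {c : PtMap Y' Q}
    {d : PtMap P Q} {ψ : d.comp b ⟶ c.comp k} (h' : IsWeakPushout b k d c ψ) :
    IsWeakPushout f (k.comp g) (d.comp a) c (d ◁ φ ≫ ψ ▷ g) := by
  have h₁ := (h.symm.paste_left h'.symm).symm
  rw [whiskerL_inv, inv_whiskerR] at h₁
  have key {C : Type u} [Groupoid.{u} C] {A B D : C} (p : A ⟶ B) (q : B ⟶ D) :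
      inv (inv q ≫ inv p) = p ≫ q := by simp
  exact h₁.congr_cell (key _ _)

/-- If the first and the composite of two squares placed side by side, along the leg `b` of the first
one, are weak pushouts, so is the second. -/
theorem of_paste_right (h : IsWeakPushout f g a b φ) {k : PtMap Y Y'} {c : PtMap Y' Q}
    {d : PtMap P Q} {ψ : d.comp b ⟶ c.comp k}
    (h' : IsWeakPushout f (k.comp g) (d.comp a) c (d ◁ φ ≫ ψ ▷ g)) : IsWeakPushout b k d c ψ := by
  have key {C : Type u} [Groupoid.{u} C] {A B D : C} (p : A ⟶ B) (q : B ⟶ D) :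
      inv (p ≫ q) = inv q ≫ inv p := by simp
  have h₁ := h.symm.of_paste_left (k := k) (c := c) (d := d) (ψ := inv ψ)
    (h'.symm.congr_cell (by rw [whiskerL_inv, inv_whiskerR]; exact key _ _))
  exact h₁.symm.congr_cell IsIso.inv_inv

end IsWeakPushout

/-! ### Chains of pushouts for the strong relative category -/

/-- The one-point space. -/
def PtTop.point : PtTop.{u} := ⟨PUnit, PUnit.unit⟩

namespace PtMap

variable {X : PtTop.{u}}

/-- The map from the one-point space. -/
def ofPoint (X : PtTop.{u}) : PtMap PtTop.point X := ⟨ContinuousMap.const _ X.pt, rfl⟩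

/-- The homotopy between two maps defined on the one-point space. -/
def pointHomotopy (f g : PtMap PtTop.point X) : PtHomotopy f g where
  toFun _ := X.pt
  continuous_toFun := continuous_const
  map_zero_left _ := f.map_pt.symm
  map_one_left _ := g.map_pt.symm
  prop' _ _ _ := f.map_pt.symm

theorem point_cell_ext {f g : PtMap PtTop.point X} (φ ψ : f ⟶ g) : φ = ψ := by
  obtain ⟨H, rfl⟩ := cell_surjective φ
  obtain ⟨K, rfl⟩ := cell_surjective ψ
  exact cell_eq_cell.2 (PtHomotopy.Equivalent.of_eq fun t _ =>
    (PtHomotopy.apply_pt H t).trans (PtHomotopy.apply_pt K t).symm)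

end PtMap

open PtMap

/-- In a relative step it suffices to give the map `s : A → Z` with strict equations; the maps to which
this is applied are defined on double mapping cylinders, where such equations hold. -/
theorem IsWeakPushout.isRelcatStep {A Xi Xj Z : PtTop.{u}} {ιi : PtMap A Xi} {ιj : PtMap A Xj}
    {p : PtMap Z A} {z : PtMap Z Xi} {χ : PtMap Xi Xj} {κ : ιj.comp p ⟶ χ.comp z}
    (h : IsWeakPushout p z ιj χ κ) (s : PtMap A Z) (hp : p.comp s = PtMap.id A)
    (hz : z.comp s = ιi) : IsRelcatStep ιi ιj := by
  obtain ⟨K, rfl⟩ := cell_surjective κ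
  refine ⟨Z, p, z, χ, K, s, isHomotopyPushout_iff.2 h, ?_, ?_⟩
  · exact hp ▸ nonempty_cell.1 ⟨𝟙 _⟩
  · exact hz ▸ nonempty_cell.1 ⟨𝟙 _⟩

/-- Let `Xi → Xj` be a pushout of `Z → A`, and suppose that the composite `A → Xi → Xj` is homotopic
to `ιj : A → Xj`. Let `Y = Xi ∪_A E` for a retract `S` of a space `E` under `A`. Then `S → Y` is
followed, in a chain for the strong relative category, by a map of the same form with `Xj` in place
of `Xi`. The pushout `Y → Y'` is taken along `Z ∨ S → S`, which has a section. -/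
theorem exists_isRelcatStep {A S E Xi Xj Z : PtTop.{u}} (ιi : PtMap A Xi) (ιj : PtMap A Xj)
    {p : PtMap Z A} {z : PtMap Z Xi} {χ : PtMap Xi Xj} {κ : ιj.comp p ⟶ χ.comp z}
    (h : IsWeakPushout p z ιj χ κ) (μ : χ.comp ιi ⟶ ιj) (e : PtMap A E) (ρ : PtMap E S)
    (s : PtMap S E) (hs : ρ.comp s = PtMap.id S) :
    ∃ (E' : PtTop.{u}) (e' : PtMap A E') (ρ' : PtMap E' S) (s' : PtMap S E'),
      ρ'.comp e' = ρ.comp e ∧ ρ'.comp s' = PtMap.id S ∧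
      IsRelcatStep ((DMC.inr ιi e).comp s) ((DMC.inr ιj e').comp s') := by
  obtain ⟨K, rfl⟩ := cell_surjective κ
  -- The pushout of `Xi → Y` along `χ` is `Xj ∪_A E`.
  obtain ⟨Γ, hΓ⟩ := cell_surjective (DMC.inl ιj e ◁ μ ≫ cell (DMC.glue ιj e))
  let k₀ : PtMap (DMC ιi e) (DMC ιj e) :=
    DMC.desc ((DMC.inl ιj e).comp χ) (DMC.inr ιj e) Γ
  have h₁ : IsWeakPushout χ (DMC.inl ιi e) (DMC.inl ιj e) k₀ (𝟙 _) := by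
    refine (DMC.isWeakPushout ιi e).of_paste_left (d := k₀) ?_
    refine ((DMC.isWeakPushout ιj e).congr_edge μ).congr_cell ?_
    exact hΓ.symm.trans (Category.id_comp (cell Γ)).symm
  have h₂ := h.paste_right h₁
  -- Hence `Xj ∪_A E` is the pushout of `A ← Z → Y`, and also that of `A ∨ S ← Z ∨ S → Y`, because
  -- `A ∨ S` is the pushout of `A ← Z → Z ∨ S`.
  let o := ofPoint Z
  let VZ := DMC o (ofPoint S)
  let VA := DMC (p.comp o) (ofPoint S)
  let pS : PtMap VZ VA := DMC.desc ((DMC.inl (p.comp o) (ofPoint S)).comp p)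
    (DMC.inr (p.comp o) (ofPoint S)) (DMC.glue (p.comp o) (ofPoint S))
  have h₃ : IsWeakPushout p (DMC.inl o (ofPoint S)) (DMC.inl (p.comp o) (ofPoint S)) pS (𝟙 _) := by
    refine (DMC.isWeakPushout o (ofPoint S)).of_paste_left (d := pS) ?_
    refine (DMC.isWeakPushout (p.comp o) (ofPoint S)).congr_cell ?_
    exact (Category.id_comp (cell (DMC.glue (p.comp o) (ofPoint S)))).symm
  let y : PtMap VZ (DMC ιi e) := DMC.desc ((DMC.inl ιi e).comp z) ((DMC.inr ιi e).comp s)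
    (pointHomotopy _ _)
  let l : PtMap VA (DMC ιj e) := DMC.desc ((DMC.inl ιj e).comp ιj) ((DMC.inr ιj e).comp s)
    (pointHomotopy _ _)
  obtain ⟨ψ, hψ, -⟩ := (DMC.isWeakPushout o (ofPoint S)).full (l.comp pS) (k₀.comp y)
    (DMC.inl ιj e ◁ cell K) (𝟙 _) (point_cell_ext _ _)
  have h₄ : IsWeakPushout pS y l k₀ ψ := by
    refine h₃.of_paste_right (d := l) ?_
    refine h₂.congr_cell ?_
    rw [hψ]
    exact (Category.comp_id (DMC.inl ιj e ◁ cell K)).trans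
      (Category.id_comp (DMC.inl ιj e ◁ cell K)).symm
  -- Pushing out along `A ∨ S → E → S` turns `Xj ∪_A E` into `Xj ∪_A E'` with `E' = E ∪_{A ∨ S} S`, since
  -- `A ∨ S → Xj ∪_A E` factors through `E` up to homotopy.
  let es : PtMap VA E := DMC.desc e s (pointHomotopy _ _)
  let q := ρ.comp es
  let e' : PtMap A (DMC es q) := (DMC.inl es q).comp e
  let d := DMC.inr ιj e'
  let k₁ : PtMap (DMC ιj e) (DMC ιj e') := DMC.desc (DMC.inl ιj e') (d.comp (DMC.inl es q))
    (DMC.glue ιj e')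
  have h₅ : IsWeakPushout (DMC.inr ιj e) (DMC.inl es q) k₁ d (𝟙 _) := by
    refine (DMC.isWeakPushout ιj e).of_paste_right (d := k₁) ?_
    refine (DMC.isWeakPushout ιj e').congr_cell ?_
    exact (Category.comp_id (cell (DMC.glue ιj e'))).symm
  have h₆ := (DMC.isWeakPushout es q).paste_left h₅
  obtain ⟨ν, -, -⟩ := (DMC.isWeakPushout (p.comp o) (ofPoint S)).full l ((DMC.inr ιj e).comp es)
    (cell (DMC.glue ιj e)) (𝟙 _) (point_cell_ext _ _)
  have h₇ := (h₆.congr_edge ν).symm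
  have h₈ := h₄.paste_left h₇
  refine ⟨DMC es q, e', DMC.desc ρ (PtMap.id S) (ContinuousMap.HomotopyRel.refl _ _),
    DMC.inr es q, rfl, rfl, ?_⟩
  exact h₈.isRelcatStep (DMC.inr o (ofPoint S)) hs rfl

/-! ### From the strong Hopf category to the strong relative category -/

/-- Weak pushouts preserve homotopy equivalences. -/
theorem IsWeakPushout.isHomotopyEquiv_right {W X Y P : PtTop.{u}} {f : PtMap W X} {g : PtMap W Y}
    {a : PtMap X P} {b : PtMap Y P} {φ : a.comp f ⟶ b.comp g} (h : IsWeakPushout f g a b φ)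
    (hf : f.IsHomotopyEquiv) : b.IsHomotopyEquiv := by
  obtain ⟨f', ⟨H⟩, -⟩ := id hf
  obtain ⟨u, -, β, -⟩ := h.desc (g.comp f') (PtMap.id Y) (g ◁ cell H)
  refine ⟨u, nonempty_cell.1 ⟨β⟩, ?_⟩
  have key {C : Type u} [Groupoid.{u} C] {A B D E : C} (p : A ⟶ B) (q : B ⟶ D) (r : E ⟶ D) :
      ∃ τ : A ⟶ E, p ≫ q = τ ≫ r := ⟨p ≫ q ≫ inv r, by simp⟩
  obtain ⟨τ, hτ⟩ : ∃ τ : (b.comp (u.comp a)).comp f ⟶ a.comp f,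
      b.comp u ◁ φ ≫ (b ◁ β) ▷ g = τ ≫ φ := key (b.comp u ◁ φ) ((b ◁ β) ▷ g) φ
  obtain ⟨α, rfl⟩ := hf.exists_whiskerR_eq (u := b.comp (u.comp a)) (v := a) τ
  obtain ⟨δ, -, -⟩ := h.full (b.comp u) (PtMap.id P) α (b ◁ β) (by rw [id_whiskerL]; exact hτ)
  exact nonempty_cell.1 ⟨δ⟩

/-- A step for the strong Hopf category whose base is a map `ιi : A → Xi` gives a step for the strong
relative category from `S → Xi ∪_A E` to `ζ : S → Xj`, for any retract `S` of a space `E` under `A`: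
writing `Z' = Z ∪_W A`, the space `Xj` is the pushout of `S ← Z' → Xi`, hence also that of
`S ← Z' ∪_A E → Xi ∪_A E`, and now `Z' ∪_A E → S` has a section. -/
theorem RelSuspension.IsHcatStep.isRelcatStep {W A S Xi Xj : PtTop.{u}} {R : RelSuspension W A S}
    {ιi : PtMap A Xi} {ιj : PtMap A Xj} {ζ : PtMap S Xj} (h : R.IsHcatStep ιi ιj ζ)
    {E : PtTop.{u}} {e : PtMap A E} {ρ : PtMap E S} {s : PtMap S E} (he : ρ.comp e = R.θ)
    (hs : ρ.comp s = PtMap.id S) : IsRelcatStep ((DMC.inr ιi e).comp s) ζ := by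
  obtain ⟨η, β, θ, H, hR⟩ := R
  dsimp only at he
  subst he
  obtain ⟨Z, p, z, χ, w, K, L, B, P, Q, hK, hcube⟩ := h
  dsimp only at L B P Q hcube
  rw [isHomotopyPushout_iff] at hK hR
  have hcube := cell_eq_cell.2 hcube
  -- `Z' = Z ∪_W A`, with its maps to `S` and to `Xi`
  obtain ⟨G, hG⟩ := cell_surjective ((ρ.comp e) ◁ cell L ≫ cell H)
  let r : PtMap (DMC w β) S := DMC.desc ((ρ.comp e).comp p) (ρ.comp e) G
  let t : PtMap (DMC w β) Xi := DMC.desc z ιi B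
  have h₁ : IsWeakPushout p (DMC.inl w β) (ρ.comp e) r (𝟙 _) := by
    refine (DMC.isWeakPushout w β).of_paste_left (d := r) ?_
    refine (hR.congr_edge (cell L)).congr_cell ?_
    exact hG.symm.trans (Category.id_comp (cell G)).symm
  -- The front, bottom and right faces of the cube agree over `W`.
  obtain ⟨M, hM₁, hM₂⟩ := (DMC.isWeakPushout w β).full (ζ.comp r) (χ.comp t)
    (cell P ▷ p ≫ cell K) (cell Q) (by
      have key {C : Type u} [Groupoid.{u} C] {a₁ a₂ a₃ a₄ a₅ a₆ a₇ : C} {h : a₁ ⟶ a₂}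
          {p : a₁ ⟶ a₃} {l : a₄ ⟶ a₃} {k : a₄ ⟶ a₅} {b : a₅ ⟶ a₆} {q : a₂ ⟶ a₆} {l' : a₇ ⟶ a₁}
          {p' : a₇ ⟶ a₄} {x : a₇ ⟶ a₂} {y : a₇ ⟶ a₅}
          (hc : h = p ≫ Groupoid.inv l ≫ k ≫ b ≫ Groupoid.inv q)
          (he : l' ≫ p = p' ≫ l) (hx : x = l' ≫ h) (hy : y = p' ≫ k) : x ≫ q = y ≫ b := by
        simp [hx, hy, hc, reassoc_of% he]
      exact key hcube (exchange (cell L) (cell P)) ((congrArg (ζ ◁ ·) hG).trans (whiskerL_comp _ _ _))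
        (comp_whiskerR _ _ _))
  have h₂ : IsWeakPushout r t ζ χ M := by
    refine h₁.of_paste_right (d := ζ) ?_
    refine (hK.congr_leg (cell P)).congr_cell ?_
    exact hM₁.symm.trans (Category.id_comp (M ▷ DMC.inl w β)).symm
  -- `Z' ∪_A E`, with its maps to `S` and to `Xi ∪_A E`
  let j := DMC.inr w β
  let q : PtMap (DMC j e) S := DMC.desc r ρ (ContinuousMap.HomotopyRel.refl _ _)
  let y : PtMap (DMC j e) (DMC ιi e) := DMC.desc ((DMC.inl ιi e).comp t) (DMC.inr ιi e)
    (DMC.glue ιi e)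
  have h₃ : IsWeakPushout t (DMC.inl j e) (DMC.inl ιi e) y (𝟙 _) := by
    refine (DMC.isWeakPushout j e).of_paste_left (d := y) ?_
    refine (DMC.isWeakPushout ιi e).congr_cell ?_
    exact (Category.id_comp (cell (DMC.glue ιi e))).symm
  let π : PtMap (DMC ιi e) Xj := DMC.desc χ (ζ.comp ρ) Q.symm
  obtain ⟨M', hM'⟩ : ∃ M' : χ.comp t ⟶ ζ.comp r, M' = inv M := ⟨_, rfl⟩
  have hM'₂ : M' ▷ DMC.inr w β = inv (cell Q) := by
    rw [hM', inv_whiskerR, hM₂]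
    rfl
  obtain ⟨N, hN₁, -⟩ := (DMC.isWeakPushout j e).full (π.comp y) (ζ.comp q) M' (𝟙 _) (by
    have key {C : Type u} [Groupoid.{u} C] {A B : C} {p : B ⟶ A} {x m : A ⟶ B} (h : x = inv p)
        (hm : m = inv p) : x ≫ 𝟙 B = m ≫ 𝟙 B := by rw [h, hm]
    exact key (cell_symm Q) hM'₂)
  have h₄ : IsWeakPushout y q π ζ N := by
    refine h₃.of_paste_right (d := π) ?_
    refine h₂.symm.congr_cell ?_
    rw [← hM']
    exact hN₁.symm.trans (Category.id_comp (N ▷ DMC.inl j e)).symm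
  exact h₄.symm.isRelcatStep ((DMC.inr j e).comp s) hs rfl

namespace RelSuspension

variable {W A S : PtTop.{u}} (R : RelSuspension W A S)

/-- A chain for the strong Hopf category that ends in `ι : A → X` gives a chain of the same length for
the strong relative category, which ends in `S → E → X ∪_A E` for a retract `S` of a space `E` under
`A`. If `ι` is a homotopy equivalence, one takes `E = S`. Of each cube, only the bottom face and the
homotopies `χ ∘ ιi ≃ ζ ∘ θ ≃ ιj` are used here. -/
theorem IsHcatChain.exists_isRelcatChain : ∀ (m : ℕ) {X : PtTop.{u}} (ι : PtMap A X),
    R.IsHcatChain m ι → ∃ (E : PtTop.{u}) (e : PtMap A E) (ρ : PtMap E S) (s : PtMap S E),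
      ρ.comp e = R.θ ∧ ρ.comp s = PtMap.id S ∧ IsRelcatChain m ((DMC.inr ι e).comp s)
  | 0, _, ι, h => ⟨S, R.θ, PtMap.id S, PtMap.id S, rfl, rfl,
      (DMC.isWeakPushout ι R.θ).isHomotopyEquiv_right h⟩
  | m + 1, _, ι, ⟨Xm, ιm, h, ζ, Z, p, z, χ, w, K, L, B, P, Q, hK, _⟩ => by
    obtain ⟨E, e, ρ, s, he, hs, hc⟩ := exists_isRelcatChain m ιm h
    obtain ⟨E', e', ρ', s', he', hs', hstep⟩ := exists_isRelcatStep ιm ι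
      (isHomotopyPushout_iff.1 hK) (inv (cell Q) ≫ cell P) e ρ s hs
    exact ⟨E', e', ρ', s', he'.trans he, hs', _, _, hc, hstep⟩

/-- The chain of `exists_isRelcatChain` is completed by `IsHcatStep.isRelcatStep`, applied to the last
cube, which ends in `f`. -/
theorem strongRelcat_le_strongHcat {X : PtTop.{u}} (f : PtMap S X) :
    strongRelcat f ≤ R.strongHcat f := by
  refine le_sInf ?_
  rintro _ ⟨m, rfl, Xm, ιm, ιn, ζ, hm, hn, hζ⟩
  obtain ⟨E, e, ρ, s, he, hs, hc⟩ := IsHcatChain.exists_isRelcatChain R m ιm hm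
  exact sInf_le ⟨m + 1, by push_cast; rfl, ζ, ⟨_, _, hc, hn.isRelcatStep he hs⟩, hζ⟩

end RelSuspension

/-! ### Comparison of Ganea constructions -/

namespace MapFactor

variable {A S X : PtTop.{u}} {θ : PtMap A S} {f : PtMap S X}

/-- A map over `X` and under `θ : A → S`, from a factorization of `f ∘ θ : A → X` to a factorization
of `f : S → X`. It commutes strictly with the maps from `A` and `S` and with the maps to `X`. -/
structure Hom (D : MapFactor (f.comp θ)) (D' : MapFactor f) where
  map : PtMap D.G D'.G
  map_α : map.comp D.α = D'.α.comp θ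
  g_map : D'.g.comp map = D.g

namespace Hom

variable {D : MapFactor (f.comp θ)} {D' : MapFactor f} (Φ : Hom D D')

/-- The induced map of homotopy pullbacks. -/
def fibre : PtMap D.F D'.F :=
  hPullback.lift f D'.g (θ.comp D.η) (Φ.map.comp D.β)
    ((hPullback.homotopy (f.comp θ) D.g).cast rfl
      (congrArg (fun k : PtMap D.G X => (k.comp D.β).toMap) Φ.g_map.symm))

/-- The induced map between the next terms of the Ganea constructions. -/
def next : Hom D.next D'.next where
  map := DMC.desc (D'.next.α.comp θ) (D'.γ.comp Φ.map)
    (PtHomotopy.pre (DMC.glue D'.η D'.β) Φ.fibre)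
  map_α := rfl
  g_map := by
    refine PtMap.ext (ContinuousMap.ext ?_)
    rintro ⟨a | q | y⟩
    · rfl
    · rfl
    · exact congrArg (fun k : PtMap D.G X => k y) Φ.g_map

/-- The maps between all the terms of the Ganea constructions of `f ∘ θ` and of `f`. -/
def ganea (θ : PtMap A S) (f : PtMap S X) : ∀ m, Hom (_root_.ganea (f.comp θ) m) (_root_.ganea f m)
  | 0 => ⟨θ, rfl, rfl⟩
  | m + 1 => (ganea θ f m).next

/-- The section `s ↦ (s, const, α s)` of the homotopy pullback of `f` and `g : G → X` over `S`. -/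
def diagonal (D' : MapFactor f) : PtMap S D'.F :=
  hPullback.lift f D'.g (PtMap.id S) D'.α
    ((ContinuousMap.HomotopyRel.refl f.toMap {S.pt}).cast rfl
      (congrArg PtMap.toMap D'.fac.symm))

end Hom

end MapFactor

namespace RelSuspension

variable {W A S X : PtTop.{u}} (R : RelSuspension W A S) (f : PtMap S X) (m : ℕ)
  {D' : MapFactor f} (Φ : MapFactor.Hom (ganea (R.ι f) m) D')

/-- The part of the path `t ↦ f (R.H (t, w))` that is left to be traversed at time `s`, as a function
of `(s, w)`. -/
def remainingPath : C(I × W, C(I, X)) :=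
  ContinuousMap.curry ⟨fun x : (I × W) × I => f (R.H (PtHomotopy.segment x.2 x.1.1 1, x.1.2)),
    f.toMap.continuous.comp ((map_continuous R.H).comp
      ((PtHomotopy.continuous_segment.comp (f := fun x : (I × W) × I => (x.2, x.1.1, (1 : I)))
        (by fun_prop)).prodMk (by fun_prop)))⟩

/-- The homotopy `R.H`, lifted to the homotopy pullback of `f` and `D'.g`: it joins the maps from `W`
given by the paths `t ↦ f (R.H (t, w))` and by constant paths. -/
def fibreHomotopy : PtHomotopy (Φ.fibre.comp (R.toFibre f m))
    ((MapFactor.Hom.diagonal D').comp (R.θ.comp R.β)) where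
  toFun q := ⟨(R.H q, R.remainingPath f q, Φ.map ((ganea (R.ι f) m).α (R.β q.2))),
    congrArg (fun t => f (R.H (t, q.2))) (PtHomotopy.segment_zero _ _), by
      refine (congrArg (fun t => f (R.H (t, q.2))) (PtHomotopy.segment_one _ _)).trans ?_
      refine (congrArg f (R.H.map_one_left q.2)).trans ?_
      refine Eq.trans ?_ (congrArg (fun k : PtMap _ X => k ((ganea (R.ι f) m).α (R.β q.2)))
        Φ.g_map).symm
      exact (congrArg (fun k : PtMap A X => k (R.β q.2)) (ganea (R.ι f) m).fac).symm⟩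
  continuous_toFun := by
    refine Continuous.subtype_mk ?_ _
    exact (map_continuous R.H).prodMk ((map_continuous (R.remainingPath f)).prodMk
      ((Φ.map.comp ((ganea (R.ι f) m).α.comp R.β)).toMap.continuous.comp continuous_snd))
  map_zero_left w := by
    refine Subtype.ext (Prod.ext (R.H.map_zero_left w) (Prod.ext ?_ rfl))
    ext t
    have h : PtHomotopy.segment t 0 1 = t := by ext; simp [PtHomotopy.segment]
    exact congrArg (fun t => f (R.H (t, w))) h
  map_one_left w := by
    refine Subtype.ext (Prod.ext (R.H.map_one_left w) (Prod.ext ?_ ?_))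
    · ext t
      exact (congrArg (fun t => f (R.H (t, w))) (PtHomotopy.segment_self t 1)).trans
        (congrArg f (R.H.map_one_left w))
    · exact congrArg (fun k : PtMap A _ => k (R.β w)) Φ.map_α
  prop' := by
    rintro s x rfl
    refine Subtype.ext (Prod.ext (R.H.prop s _ rfl) (Prod.ext ?_ rfl))
    ext t
    exact congrArg f ((R.H.prop _ _ rfl).trans (R.H.prop t _ rfl).symm)

/-- The map of factorizations carries `ω` to the structure map of `D'.next`, up to homotopy: over the
left end of the cylinder they agree, over the right end they differ by the glueing homotopy of
`D'.next` along the diagonal section of `D'.F`, and over the cylinder `fibreHomotopy` compares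
them. -/
theorem homotopic_omegaDMC :
    PtHomotopic (Φ.next.map.comp (R.omegaDMC f m)) (D'.next.α.comp R.fromDMC) := by
  let E : PtHomotopy (Φ.map.comp (ganea (R.ι f) m).α) (D'.α.comp R.θ) :=
    (ContinuousMap.HomotopyRel.refl _ _).cast rfl (congrArg PtMap.toMap Φ.map_α)
  have h₁ : D'.η ◁ cell (R.fibreHomotopy f m Φ) = cell R.H :=
    cell_eq_cell.2 (PtHomotopy.Equivalent.of_eq fun t w => rfl)
  have h₂ : D'.β ◁ cell (R.fibreHomotopy f m Φ) = cell E ▷ R.β :=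
    cell_eq_cell.2 (PtHomotopy.Equivalent.of_eq fun t w => rfl)
  have h₃ := exchange (cell (R.fibreHomotopy f m Φ)) (cell (DMC.glue D'.η D'.β))
  obtain ⟨C, hC⟩ := cell_surjective
    (inv (cell (DMC.glue D'.η D'.β) ▷ ((MapFactor.Hom.diagonal D').comp R.θ)))
  obtain ⟨δ, -, -⟩ := (DMC.isWeakPushout R.η R.β).full (Φ.next.map.comp (R.omegaDMC f m))
    (D'.next.α.comp R.fromDMC) (𝟙 _) (D'.γ ◁ cell E ≫ cell C) (by
      have key {C : Type u} [Groupoid.{u} C] {a₁ a₂ a₃ a₄ : C} {h h' : a₁ ⟶ a₂} {c : a₂ ⟶ a₃}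
          {g : a₁ ⟶ a₄} {k k' : a₄ ⟶ a₃} {c' : a₃ ⟶ a₂} {y : a₄ ⟶ a₂} (e : h ≫ c = g ≫ k)
          (hh : h = h') (hk : k = k') (hc : c' = inv c) (hy : y = k' ≫ c') :
          g ≫ y = 𝟙 a₁ ≫ h' := by
        rw [hy, hc, ← hk, ← hh, ← reassoc_of% e]
        simp
      exact key h₃ (congrArg ((DMC.inl D'.η D'.β) ◁ ·) h₁) (congrArg (D'.γ ◁ ·) h₂)
        ((congrArg (· ▷ R.β) hC).trans (inv_whiskerR _ _)) (comp_whiskerR _ _ _))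
  exact nonempty_cell.1 ⟨δ⟩

/-- A section of the Ganea construction of `f ∘ θ` compatible with `ω` becomes, under the comparison
map, a section of the Ganea construction of `f` compatible with its structure map. -/
theorem relcat_le_hcat : relcat f ≤ R.hcat f := by
  refine le_sInf ?_
  rintro _ ⟨m, rfl, s, hs, hω⟩
  let Φ := MapFactor.Hom.ganea R.θ f
  refine sInf_le ⟨m + 1, by push_cast; rfl, (Φ (m + 1)).map.comp s, ?_, ?_⟩
  · have h : ((ganea f (m + 1)).g.comp (Φ (m + 1)).map).comp s = (ganea (R.ι f) (m + 1)).g.comp s :=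
      congrArg (fun k : PtMap _ X => k.comp s) (Φ (m + 1)).g_map
    change PtHomotopic (((ganea f (m + 1)).g.comp (Φ (m + 1)).map).comp s) _
    rw [h]
    exact hs
  · obtain ⟨σ₁⟩ := nonempty_cell.2 hω
    obtain ⟨σ₂⟩ := nonempty_cell.2 (R.homotopic_omegaDMC f m (Φ m))
    obtain ⟨σ₃⟩ := nonempty_cell.2 R.isPushout.choose_spec.2
    exact nonempty_cell.1 ⟨(Φ (m + 1)).map ◁ σ₁ ≫ σ₂ ▷ R.toDMC ≫ (ganea f (m + 1)).α ◁ σ₃⟩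

end RelSuspension

theorem mainTheorem2 {W A S X : PtTop.{u}} (R : RelSuspension W A S) (f : PtMap S X) :
    strongRelcat f ≤ R.strongHcat f ∧ relcat f ≤ R.hcat f := by
  exact ⟨R.strongRelcat_le_strongHcat f, R.relcat_le_hcat f⟩
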